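/- Let $\mathcal A=\{p_1,\dots,p_n\}$ be a set of $n$ distinct points in $\mathbb R^2$, no three of them collinear, and let $p_a,p_b$ be two of the points that do not lie on a common horizontal line (for instance $a=1$, $b=2$, after relabelling). Let $$S:=\{(v,t)\in(\mathbb R^2)^n\times\mathbb R^n : v_a^1=v_a^2=v_b^1=0\}.$$ For a vector $f\in\mathbb R^{\binom{n+1}{2}}$, with entries $f_{ij}=f_{ji}$ indexed by the pairs of distinct $i,j\in\{0,1,\dots,n\}$, let $\overline{Y_f}(\mathcal A)$ be the polyhedron of all $(v,t)\in S$ such that $$\langle p_i-p_j,v_i-v_j\rangle-|p_i-p_j|(t_i+t_j)\ \ge\ f_{ij}\quad(1\le i<j\le n),\qquad t_j\ \ge\ f_{0j}\quad(1\le j\le n).$$ The tight marked graph of a point $(v,t)$ of $\overline{Y_f}(\mathcal A)$ is the graph drawn with straight edges on $\mathcal A$ whose edges are the $p_ip_j$ for which the corresponding inequality is an equality at $(v,t)$, together with the set of marked vertices $p_j$ for which $t_j=f_{0j}$. The tight marked graph $T(F)$ of a non-empty face $F$ of $\overline{Y_f}(\mathcal A)$ is that of any relative interior point of $F$. A marked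 graph is non-crossing if any two different edges meet at most in a common end-point and every marked vertex is pointed, i.e. its incident edges span an angle smaller than $180^\circ$ (they lie in an open half-plane bounded by a line through the vertex, apart from the vertex itself). The vector $f$ is called valid if $T(F)$ is non-crossing for every non-empty face $F$ of $\overline{Y_f}(\mathcal A)$. Theorem. A vector $f\in\mathbb R^{\binom{n+1}{2}}$ is valid if and only if, for every four points of $\mathcal A$, which we denote $p_1,p_2,p_3,p_4$ for simplicity, $$\sum_{1\le i<j\le 4} w_{ij}f_{ij}+\sum_{j=1}^4\alpha_jf_{0j}>0,$$ where $$w_{ij}=\frac1{\det(p_i,p_j,p_k)\det(p_i,p_j,p_l)},\quad \{k,l\}=\{1,2,3,4\}\setminus\{i,j\},\qquad \alpha_i=\sum_{j\in\{1,2,3,4\}\setminus\{i\}}w_{ij}\,|p_i-p_j|,$$ and $\det(q_1,q_2,q_3)$ is the determinant of the $3\times3$ matrix with columns $(1,q_1),(1,q_2),(1,q_3)$, i.e. twice the signed area of the triangle $q_1q_2q_3$. -/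

import Mathlib

open scoped InnerProductSpace

namespace ExpansionPolyhedron

/-- The Euclidean plane. -/
abbrev Plane : Type := EuclideanSpace ℝ (Fin 2)

/-- The points `p i` are pairwise distinct and no three of them lie on a line. -/
def GeneralPosition {n : ℕ} (p : Fin n → Plane) : Prop :=
  Function.Injective p ∧
    ∀ i j k : Fin n, i ≠ j → i ≠ k → j ≠ k → ¬ Collinear ℝ {p i, p j, p k}

/-! ### Marked geometric graphs -/

/-- A marked graph: a graph together with a subset of its vertices, the marked ones.
Placing vertex `i` at the point `p i` and drawing edges as straight segments makes it a marked
geometric graph. -/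
structure MarkedGraph (n : ℕ) where
  /-- the edges -/
  graph : SimpleGraph (Fin n)
  /-- the marked vertices -/
  marks : Set (Fin n)

/-- The straight-line drawing of `G` on `p` has no crossings: two different edges meet at most in
a common end-point. -/
def PlaneDrawing {n : ℕ} (p : Fin n → Plane) (G : SimpleGraph (Fin n)) : Prop :=
  ∀ i j k l : Fin n, G.Adj i j → G.Adj k l → s(i, j) ≠ s(k, l) →
    segment ℝ (p i) (p j) ∩ segment ℝ (p k) (p l) ⊆ ({p i, p j} ∩ {p k, p l} : Set Plane)

/-- A vertex is pointed if its incident edges span an angle smaller than 180 degrees, i.e. they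
all leave the vertex into one open half-plane bounded by a line through it. -/
def Pointed {n : ℕ} (p : Fin n → Plane) (G : SimpleGraph (Fin n)) (i : Fin n) : Prop :=
  ∃ u : Plane, ∀ j : Fin n, G.Adj i j → 0 < ⟪u, p j - p i⟫_ℝ

/-- A marked graph is non-crossing if it is so as a graph and only pointed vertices are marked. -/
def MarkedGraph.NonCrossing {n : ℕ} (p : Fin n → Plane) (T : MarkedGraph n) : Prop :=
  PlaneDrawing p T.graph ∧ ∀ i ∈ T.marks, Pointed p T.graph i

/-! ### The polyhedron of expansions constrained by `f` -/

/-- The vectors `(v, t) ∈ (ℝ²)ⁿ × ℝⁿ`. -/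
abbrev Motion (n : ℕ) : Type := (Fin n → Plane) × (Fin n → ℝ)

/-- Parameter vectors `f`, with an entry for each pair of indices in `{0, 1, …, n}`. Index `0` is
the extra index, and `i.succ` is the index of the point `p i`. Only entries at pairs of two
different indices are ever used. -/
abbrev Params (n : ℕ) : Type := Sym2 (Fin (n + 1)) → ℝ

/-- The entry `f_{ij}` for two points. -/
def Params.edge {n : ℕ} (f : Params n) (i j : Fin n) : ℝ := f s(i.succ, j.succ)

/-- The entry `f_{0j}`. -/
def Params.vertex {n : ℕ} (f : Params n) (j : Fin n) : ℝ := f s(0, j.succ)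

/-- The linear form `⟨p_i - p_j, v_i - v_j⟩ - |p_i - p_j| (t_i + t_j)`. -/
noncomputable def edgeForm {n : ℕ} (p : Fin n → Plane) (x : Motion n) (i j : Fin n) : ℝ :=
  ⟪p i - p j, x.1 i - x.1 j⟫_ℝ - ‖p i - p j‖ * (x.2 i + x.2 j)

theorem edgeForm_comm {n : ℕ} (p : Fin n → Plane) (x : Motion n) (i j : Fin n) :
    edgeForm p x i j = edgeForm p x j i := by
  unfold edgeForm
  rw [← neg_sub (p j) (p i), ← neg_sub (x.1 j) (x.1 i), inner_neg_neg, norm_neg,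
    add_comm (x.2 i)]

theorem Params.edge_comm {n : ℕ} (f : Params n) (i j : Fin n) : f.edge i j = f.edge j i := by
  unfold Params.edge
  rw [Sym2.eq_swap]

/-- The normalized space `S`: both coordinates of the velocity of point `a` and the first
coordinate of the velocity of point `b` vanish. -/
def normalized {n : ℕ} (a b : Fin n) : Set (Motion n) :=
  {x | x.1 a 0 = 0 ∧ x.1 a 1 = 0 ∧ x.1 b 0 = 0}

/-- The polyhedron of expansions constrained by `f`, inside the normalized space. -/
def polyhedron {n : ℕ} (p : Fin n → Plane) (a b : Fin n) (f : Params n) : Set (Motion n) :=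
  {x | x ∈ normalized a b ∧ (∀ i j : Fin n, i ≠ j → f.edge i j ≤ edgeForm p x i j) ∧
    ∀ j : Fin n, f.vertex j ≤ x.2 j}

/-- The marked graph of edges and vertices whose constraints are tight at `x`. -/
def tightGraph {n : ℕ} (p : Fin n → Plane) (f : Params n) (x : Motion n) : MarkedGraph n where
  graph :=
    { Adj := fun i j => i ≠ j ∧ edgeForm p x i j = f.edge i j
      symm := ⟨fun i j h => ⟨h.1.symm, by rw [edgeForm_comm, h.2, f.edge_comm]⟩⟩
      loopless := ⟨fun _ h => h.1 rfl⟩ }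
  marks := {j | x.2 j = f.vertex j}

/-- `f` is valid if the tight marked graph of every (non-empty) face of the polyhedron is
non-crossing, where the tight marked graph of a face is the one of any of its relative interior
points. -/
def IsValid {n : ℕ} (p : Fin n → Plane) (a b : Fin n) (f : Params n) : Prop :=
  ∀ F : Set (Motion n), IsExposed ℝ (polyhedron p a b f) F → F.Nonempty →
    ∀ x ∈ intrinsicInterior ℝ F, (tightGraph p f x).NonCrossing p

/-! ### The rescaled stress of four points -/

/-- `det(q₁, q₂, q₃)`, twice the signed area of the triangle with these vertices. -/
noncomputable def det3 (q₁ q₂ q₃ : Plane) : ℝ :=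
  Matrix.det !![1, 1, 1; q₁ 0, q₂ 0, q₃ 0; q₁ 1, q₂ 1, q₃ 1]

/-- `w_{ij} = 1 / (det(q_i, q_j, q_k) det(q_i, q_j, q_l))`, where `k` and `l` are the two indices
other than `i` and `j`. -/
noncomputable def stressW (q : Fin 4 → Plane) (i j : Fin 4) : ℝ :=
  1 / ∏ k ∈ Finset.univ.filter (fun k => k ≠ i ∧ k ≠ j), det3 (q i) (q j) (q k)

/-- `α_i = ∑_{j ≠ i} w_{ij} |q_i - q_j|`. -/
noncomputable def stressα (q : Fin 4 → Plane) (i : Fin 4) : ℝ :=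
  ∑ j ∈ Finset.univ.filter (fun j => j ≠ i), stressW q i j * ‖q i - q j‖

end ExpansionPolyhedron

namespace ExpansionPolyhedron

/-! Four points in general position carry, up to scaling, one self-stress. If `a` is an affine
dependence among them, then `w i j` is a positive multiple of `-(a i * a j * ∏ k, a k)`. In convex
position it is therefore negative exactly on the two diagonals, and every `α i` is non-negative; if
one point lies inside the triangle of the others, it is negative exactly on the three edges at that
point, the only place where `α` is negative. So a marked graph fails to be non-crossing iff it
contains, for some four points, all edges and marks of negative stress
(`MarkedGraph.not_nonCrossing`, `MarkedGraph.exists_stress_of_not_nonCrossing`).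

Equilibrium makes `(w, α)` a linear dependence of the constraint forms, so the stress-weighted sum
of the slacks is a constant, a negative multiple of the expression in the theorem
(`sum_stress_mul_slack`). If that expression is positive, the negative-stress constraints cannot all
be tight, because the remaining terms are non-negative.

Conversely, let `f` be valid. Minimize the negative part of the stress over the polyhedron and take
a relative interior point of the optimal face. Its tight graph `T` is non-crossing, and linear
programming duality writes the objective as a non-negative combination of tight constraints.
Pointedness of marked vertices confines this combination to the four points, where it differs from
the negative part by a multiple `s` of the stress. If `s < 1`, all negative edges and marks would be
in `T`, a crossing; hence `1 ≤ s` and all positive ones are tight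
(`MarkedGraph.NonCrossing.of_multipliers`). Now the weighted slack sum is at most `0`, and it is not
`0` because some negative-stress constraint is slack. -/

/-! ### Linear programming -/

/-- Farkas' lemma. -/
theorem farkas {ι V : Type*} [AddCommGroup V] [Module ℝ V] (a : ι → V →ₗ[ℝ] ℝ) (s : Finset ι) :
    ∀ c : V →ₗ[ℝ] ℝ, (∀ x, (∀ i ∈ s, 0 ≤ a i x) → 0 ≤ c x) →
      ∃ y : ι → ℝ, (∀ i, 0 ≤ y i) ∧ (∀ i ∉ s, y i = 0) ∧ ∀ x, c x = ∑ i ∈ s, y i * a i x := by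
  classical
  induction s using Finset.induction_on generalizing a with
  | empty =>
    intro c h
    refine ⟨fun _ => 0, fun _ => le_rfl, fun _ _ => rfl, fun x => ?_⟩
    have h1 := h x (by simp)
    have h2 := h (-x) (by simp)
    rw [map_neg] at h2
    simp only [Finset.sum_empty]
    linarith
  | insert k s hk ih =>
    intro c h
    by_cases hs : ∀ x, (∀ i ∈ s, 0 ≤ a i x) → 0 ≤ c x
    · obtain ⟨y, hy0, hys, hy⟩ := ih a c hs
      refine ⟨y, hy0, fun i hi => hys i (fun h' => hi (Finset.mem_insert_of_mem h')), fun x => ?_⟩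
      rw [Finset.sum_insert hk, hys k hk, hy x]
      ring
    · push Not at hs
      obtain ⟨x₁, hx₁, hc₁⟩ := hs
      have hk₁ : a k x₁ < 0 := by
        by_contra hk₁
        push Not at hk₁
        exact absurd (h x₁ (by simpa [Finset.forall_mem_insert] using ⟨hk₁, hx₁⟩)) (not_le.2 hc₁)
      obtain ⟨x₀, hx₀, hc₀, hk₀⟩ : ∃ x₀, (∀ i ∈ s, 0 ≤ a i x₀) ∧ c x₀ < 0 ∧ a k x₀ = -1 := by
        refine ⟨(-(a k x₁))⁻¹ • x₁, fun i hi => ?_, ?_, ?_⟩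
        · rw [map_smul, smul_eq_mul]
          exact mul_nonneg (inv_nonneg.2 (by linarith)) (hx₁ i hi)
        · rw [map_smul, smul_eq_mul]
          exact mul_neg_of_pos_of_neg (inv_pos.2 (by linarith)) hc₁
        · rw [map_smul, smul_eq_mul]
          rw [inv_neg, neg_mul, inv_mul_cancel₀ hk₁.ne]
      -- These are the forms composed with `x ↦ x + a k x • x₀`, the projection onto the kernel of
      -- `a k` along `x₀`, where constraint `k` holds trivially.
      obtain ⟨y, hy0, hys, hy⟩ := ih (fun i => a i + a i x₀ • a k) (c + c x₀ • a k) (by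
        intro x hx
        have key := h (x + a k x • x₀) (by
          intro i hi
          rcases Finset.mem_insert.1 hi with rfl | hi
          · simp [hk₀]
          · have := hx i hi
            simp only [LinearMap.add_apply, LinearMap.smul_apply, smul_eq_mul] at this
            simp only [map_add, map_smul, smul_eq_mul]
            linarith)
        simp only [map_add, map_smul, smul_eq_mul] at key
        simp only [LinearMap.add_apply, LinearMap.smul_apply, smul_eq_mul]
        linarith)
      refine ⟨fun i => if i = k then ∑ i ∈ s, y i * a i x₀ - c x₀ else y i, fun i => ?_,
        fun i hi => ?_, fun x => ?_⟩
      · beta_reduce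
        split_ifs
        · have := Finset.sum_nonneg fun i hi => mul_nonneg (hy0 i) (hx₀ i hi)
          linarith
        · exact hy0 i
      · rw [Finset.mem_insert, not_or] at hi
        beta_reduce
        rw [if_neg hi.1, hys i hi.2]
      · have hsum : ∑ i ∈ s, (if i = k then ∑ i ∈ s, y i * a i x₀ - c x₀ else y i) * a i x
            = ∑ i ∈ s, y i * a i x :=
          Finset.sum_congr rfl fun i hi => by rw [if_neg (ne_of_mem_of_not_mem hi hk)]
        beta_reduce
        rw [Finset.sum_insert hk, hsum, if_pos rfl]
        have hyx := hy x
        simp only [LinearMap.add_apply, LinearMap.smul_apply, smul_eq_mul, mul_add,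
          Finset.sum_add_distrib] at hyx
        rw [sub_mul, Finset.sum_mul]
        simp only [mul_assoc]
        linarith

/-- A linear function that is bounded below on a non-empty polyhedron attains its minimum. -/
theorem exists_forall_le_of_polyhedron {ι V : Type*} [Fintype ι] [AddCommGroup V] [Module ℝ V]
    (a : ι → V →ₗ[ℝ] ℝ) (b : ι → ℝ) (c : V →ₗ[ℝ] ℝ) (x₀ : V) (hx₀ : ∀ i, b i ≤ a i x₀)
    (m : ℝ) (hm : ∀ x, (∀ i, b i ≤ a i x) → m ≤ c x) :
    ∃ x, (∀ i, b i ≤ a i x) ∧ ∀ z, (∀ i, b i ≤ a i z) → c x ≤ c z := by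
  set C : Set ℝ := c '' {x | ∀ i, b i ≤ a i x}
  have hCne : C.Nonempty := ⟨c x₀, x₀, hx₀, rfl⟩
  have hCbdd : BddBelow C := ⟨m, by rintro _ ⟨x, hx, rfl⟩; exact hm x hx⟩
  set γ := sInf C
  have hγ : ∀ z, (∀ i, b i ≤ a i z) → γ ≤ c z := fun z hz => csInf_le hCbdd ⟨z, hz, rfl⟩
  by_contra hno
  push Not at hno
  have hno' : ∀ x, (∀ i, b i ≤ a i x) → γ < c x := by
    intro x hx
    obtain ⟨z, hz, hzx⟩ := hno x hx
    exact (hγ z hz).trans_lt hzx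
  -- Homogenization by a coordinate `τ`. If the infimum `γ` is not attained, the cone `c x ≤ γ τ`,
  -- `b i * τ ≤ a i x`, `0 ≤ τ` has no point with `τ > 0`, so Farkas' lemma applies to `-τ`.
  let A : Option (Option ι) → (V × ℝ) →ₗ[ℝ] ℝ := fun o => match o with
    | none => LinearMap.snd ℝ V ℝ
    | some none => γ • LinearMap.snd ℝ V ℝ - c ∘ₗ LinearMap.fst ℝ V ℝ
    | some (some i) => a i ∘ₗ LinearMap.fst ℝ V ℝ - b i • LinearMap.snd ℝ V ℝ
  obtain ⟨y, hy0, -, hy⟩ := farkas A Finset.univ (-LinearMap.snd ℝ V ℝ) (by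
    rintro ⟨x, τ⟩ hx
    have h1 : 0 ≤ τ := hx none (Finset.mem_univ _)
    have h2 : 0 ≤ γ * τ - c x := hx (some none) (Finset.mem_univ _)
    have h3 : ∀ i, 0 ≤ a i x - b i * τ := fun i => hx (some (some i)) (Finset.mem_univ _)
    change 0 ≤ -τ
    by_contra hτ
    have hτ' : 0 < τ := by linarith
    have := hno' (τ⁻¹ • x) (fun i => by
      rw [map_smul, smul_eq_mul, le_inv_mul_iff₀ hτ']
      linarith [h3 i])
    rw [map_smul, smul_eq_mul, lt_inv_mul_iff₀ hτ'] at this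
    linarith)
  have hy' : ∀ (x : V) (τ : ℝ), -τ = y none * τ + (y (some none) * (γ * τ - c x) +
      ∑ i, y (some (some i)) * (a i x - b i * τ)) := by
    intro x τ
    have := hy (x, τ)
    rw [Fintype.sum_option, Fintype.sum_option] at this
    exact this
  have hpos : 0 < y (some none) + 1 := by linarith [hy0 (some none)]
  -- At `τ = 1` the multipliers force `y (some none) * (c x - γ) ≥ 1` for every feasible `x`; a
  -- value this close to the infimum violates it.
  obtain ⟨_, ⟨x, hx, rfl⟩, hxlt⟩ := exists_lt_of_csInf_lt hCne
    (show sInf C < γ + (y (some none) + 1)⁻¹ from by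
      have := inv_pos.2 hpos
      change γ < _
      linarith)
  have hsum : 0 ≤ ∑ i, y (some (some i)) * (a i x - b i * 1) :=
    Finset.sum_nonneg fun i _ => mul_nonneg (hy0 _) (by linarith [hx i])
  have h1 := hy' x 1
  have h2 : y (some none) * (c x - γ) ≤ y (some none) * (y (some none) + 1)⁻¹ :=
    mul_le_mul_of_nonneg_left (by linarith) (hy0 _)
  have h3 : y (some none) * (y (some none) + 1)⁻¹ < 1 := by
    rw [← div_eq_mul_inv, div_lt_one hpos]
    linarith
  linarith [hy0 none]

/-- Multipliers at a minimizer of a linear function on a polyhedron. -/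
theorem exists_multipliers_of_minimizer {ι V : Type*} [Fintype ι] [AddCommGroup V] [Module ℝ V]
    (a : ι → V →ₗ[ℝ] ℝ) (b : ι → ℝ) (c : V →ₗ[ℝ] ℝ) (x : V) (hx : ∀ i, b i ≤ a i x)
    (hmin : ∀ z, (∀ i, b i ≤ a i z) → c x ≤ c z) :
    ∃ y : ι → ℝ, (∀ i, 0 ≤ y i) ∧ (∀ i, y i ≠ 0 → a i x = b i) ∧
      ∀ z, c z = ∑ i, y i * a i z := by
  classical
  obtain ⟨y, hy0, hys, hy⟩ := farkas a (Finset.univ.filter fun i => a i x = b i) c (by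
    intro d hd
    -- A direction that decreases no tight form stays feasible for small steps, since the finitely
    -- many other constraints have positive slack.
    have hev : ∀ᶠ ε : ℝ in nhdsWithin 0 (Set.Ioi 0), ∀ i, b i ≤ a i (x + ε • d) := by
      rw [Filter.eventually_all]
      intro i
      simp only [map_add, map_smul, smul_eq_mul]
      rcases (hx i).eq_or_lt with h | h
      · filter_upwards [self_mem_nhdsWithin] with ε hε
        have := mul_nonneg (le_of_lt (Set.mem_Ioi.1 hε)) (hd i (by simp [h]))
        linarith
      · have hcont : ContinuousAt (fun ε : ℝ => a i x + ε * a i d) 0 := by fun_prop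
        have := hcont.eventually (lt_mem_nhds (b := a i x + 0 * a i d) (a := b i) (by linarith))
        filter_upwards [nhdsWithin_le_nhds this] with ε hε using hε.le
    obtain ⟨ε, hε, hε0⟩ := (hev.and self_mem_nhdsWithin).exists
    have := hmin _ hε
    simp only [map_add, map_smul, smul_eq_mul] at this
    exact nonneg_of_mul_nonneg_right (by linarith) (Set.mem_Ioi.1 hε0))
  refine ⟨y, hy0, fun i hi => ?_, fun z => ?_⟩
  · by_contra h
    exact hi (hys i (by simpa using h))
  · rw [hy z]
    exact Finset.sum_subset (Finset.subset_univ _) fun i _ hi => by rw [hys i hi, zero_mul]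

/-! ### Determinants and affine dependences -/

theorem det3_eq (q₁ q₂ q₃ : Plane) :
    det3 q₁ q₂ q₃ = (q₂ 0 - q₁ 0) * (q₃ 1 - q₁ 1) - (q₃ 0 - q₁ 0) * (q₂ 1 - q₁ 1) := by
  rw [det3, Matrix.det_fin_three]
  simp
  ring

theorem det3_ne_zero {q₁ q₂ q₃ : Plane} (h : ¬ Collinear ℝ {q₁, q₂, q₃}) : det3 q₁ q₂ q₃ ≠ 0 := by
  intro h0
  apply h
  rw [det3_eq] at h0
  by_cases h12 : q₁ = q₂
  · subst h12
    simpa using collinear_pair ℝ q₁ q₃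
  have hd : (q₂ 0 - q₁ 0) ^ 2 + (q₂ 1 - q₁ 1) ^ 2 ≠ 0 := by
    intro h'
    apply h12
    ext k
    fin_cases k
    · change q₁ 0 = q₂ 0
      nlinarith [sq_nonneg (q₂ 0 - q₁ 0), sq_nonneg (q₂ 1 - q₁ 1)]
    · change q₁ 1 = q₂ 1
      nlinarith [sq_nonneg (q₂ 0 - q₁ 0), sq_nonneg (q₂ 1 - q₁ 1)]
  rw [collinear_iff_of_mem (p₀ := q₁) (by simp)]
  refine ⟨q₂ - q₁, fun q hq => ?_⟩
  simp only [Set.mem_insert_iff, Set.mem_singleton_iff] at hq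
  rcases hq with rfl | rfl | rfl
  · exact ⟨0, by simp⟩
  · exact ⟨1, by simp⟩
  · refine ⟨((q 0 - q₁ 0) * (q₂ 0 - q₁ 0) + (q 1 - q₁ 1) * (q₂ 1 - q₁ 1)) /
      ((q₂ 0 - q₁ 0) ^ 2 + (q₂ 1 - q₁ 1) ^ 2), ?_⟩
    ext k
    fin_cases k
    · simp
      field_simp
      linear_combination (-(q₂ 1 - q₁ 1)) * h0
    · simp
      field_simp
      linear_combination (q₂ 0 - q₁ 0) * h0

theorem GeneralPosition.det3_ne_zero {n : ℕ} {p : Fin n → Plane} (hp : GeneralPosition p)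
    {i j k : Fin n} (hij : i ≠ j) (hik : i ≠ k) (hjk : j ≠ k) : det3 (p i) (p j) (p k) ≠ 0 :=
  ExpansionPolyhedron.det3_ne_zero (hp.2 i j k hij hik hjk)

theorem GeneralPosition.comp {m n : ℕ} {p : Fin n → Plane} (hp : GeneralPosition p)
    (σ : Fin m ↪ Fin n) : GeneralPosition (p ∘ σ) :=
  ⟨hp.1.comp σ.injective, fun _ _ _ hij hik hjk =>
    hp.2 _ _ _ (σ.injective.ne hij) (σ.injective.ne hik) (σ.injective.ne hjk)⟩

/-- The affine dependence of four points given by the areas of the triangles they span. -/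
noncomputable def affDep (q : Fin 4 → Plane) : Fin 4 → ℝ :=
  ![det3 (q 1) (q 2) (q 3), -det3 (q 0) (q 2) (q 3), det3 (q 0) (q 1) (q 3),
    -det3 (q 0) (q 1) (q 2)]

/-- A nowhere vanishing affine dependence of four points. -/
structure IsAffDep (q : Fin 4 → Plane) (a : Fin 4 → ℝ) : Prop where
  ne_zero : ∀ i, a i ≠ 0
  sum_eq : ∑ i, a i = 0
  sum_smul_eq : ∑ i, a i • q i = 0

theorem IsAffDep.coord {q : Fin 4 → Plane} {a : Fin 4 → ℝ} (h : IsAffDep q a) (k : Fin 2) :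
    a 0 * q 0 k + a 1 * q 1 k + a 2 * q 2 k + a 3 * q 3 k = 0 := by
  have := congrArg (fun z : Plane => z k) h.sum_smul_eq
  simpa [Fin.sum_univ_four] using this

theorem isAffDep_affDep {q : Fin 4 → Plane} (hq : GeneralPosition q) : IsAffDep q (affDep q) where
  ne_zero := by
    intro i
    fin_cases i <;> simp only [affDep] <;>
      simp [hq.det3_ne_zero (show (1 : Fin 4) ≠ 2 by decide) (show (1 : Fin 4) ≠ 3 by decide)
          (show (2 : Fin 4) ≠ 3 by decide),
        hq.det3_ne_zero (show (0 : Fin 4) ≠ 2 by decide) (show (0 : Fin 4) ≠ 3 by decide)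
          (show (2 : Fin 4) ≠ 3 by decide),
        hq.det3_ne_zero (show (0 : Fin 4) ≠ 1 by decide) (show (0 : Fin 4) ≠ 3 by decide)
          (show (1 : Fin 4) ≠ 3 by decide),
        hq.det3_ne_zero (show (0 : Fin 4) ≠ 1 by decide) (show (0 : Fin 4) ≠ 2 by decide)
          (show (1 : Fin 4) ≠ 2 by decide)]
  sum_eq := by
    simp [Fin.sum_univ_four, affDep, det3_eq]
    ring
  sum_smul_eq := by
    ext k
    fin_cases k <;> simp [Fin.sum_univ_four, affDep, det3_eq] <;> ring

/-- Cramer's rule: a dependence is proportional to the triangle areas. Cross-multiplication avoids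
dividing. -/
theorem IsAffDep.affDep_mul {q : Fin 4 → Plane} {a : Fin 4 → ℝ} (h : IsAffDep q a) (i : Fin 4) :
    affDep q i * a 0 = affDep q 0 * a i := by
  have h0 := h.coord 0
  have h1 := h.coord 1
  have hs := h.sum_eq
  rw [Fin.sum_univ_four] at hs
  have e : a 3 = -a 0 - a 1 - a 2 := by linarith
  rw [e] at h0 h1
  fin_cases i
  · simp
  · simp [affDep, det3_eq]
    linear_combination (q 3 1 - q 2 1) * h0 - (q 3 0 - q 2 0) * h1
  · simp [affDep, det3_eq]
    linear_combination (-(q 3 1 - q 1 1)) * h0 + (q 3 0 - q 1 0) * h1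
  · simp [affDep, det3_eq]
    rw [e]
    linear_combination (-(q 1 1 - q 2 1)) * h0 + (q 1 0 - q 2 0) * h1

theorem stressW_comm (q : Fin 4 → Plane) (i j : Fin 4) : stressW q i j = stressW q j i := by
  have : ∀ u v w : Plane, det3 u v w = -det3 v u w := by
    intro u v w
    simp only [det3_eq]
    ring
  fin_cases i <;> fin_cases j <;>
    simp [stressW, Finset.prod_filter, Fin.prod_univ_four, this (q 1) (q 0), this (q 2) (q 0),
      this (q 3) (q 0), this (q 2) (q 1), this (q 3) (q 1), this (q 3) (q 2)]

/-- The product contains a determinant with two equal columns, so the value is `1 / 0 = 0`. Sums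
over all pairs may thus include the diagonal. -/
theorem stressW_self (q : Fin 4 → Plane) (i : Fin 4) : stressW q i i = 0 := by
  have : ∀ u v : Plane, det3 u u v = 0 := by
    intro u v
    simp [det3_eq]
  fin_cases i <;> simp [stressW, this] <;>
    first | exact ⟨1, by decide⟩ | exact ⟨0, by decide⟩

/-- The two determinants in the denominator are, up to sign, the areas belonging to the two other
indices, so they cancel from the product; the signs always combine to a minus. -/
theorem stressW_mul_prod {q : Fin 4 → Plane} (hq : GeneralPosition q) {i j : Fin 4} (hij : i ≠ j) :
    stressW q i j * ∏ k, affDep q k = -(affDep q i * affDep q j) := by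
  have hA := (isAffDep_affDep hq).ne_zero
  have key : ∀ i j : Fin 4, i < j →
      stressW q i j * ∏ k, affDep q k = -(affDep q i * affDep q j) := by
    intro i j hij
    have h0 := hA 0
    have h1 := hA 1
    have h2 := hA 2
    have h3 := hA 3
    have e0 : det3 (q 1) (q 2) (q 3) = affDep q 0 := rfl
    have e1 : det3 (q 0) (q 2) (q 3) = -affDep q 1 := by simp [affDep]
    have e2 : det3 (q 0) (q 1) (q 3) = affDep q 2 := rfl
    have e3 : det3 (q 0) (q 1) (q 2) = -affDep q 3 := by simp [affDep]
    have s1 : ∀ u v w : Plane, det3 u v w = -det3 v u w := by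
      intro u v w
      simp only [det3_eq]
      ring
    have s2 : ∀ u v w : Plane, det3 u v w = -det3 u w v := by
      intro u v w
      simp only [det3_eq]
      ring
    have d021 : det3 (q 0) (q 2) (q 1) = affDep q 3 := by rw [s2, e3]; ring
    have d031 : det3 (q 0) (q 3) (q 1) = -affDep q 2 := by rw [s2, e2]
    have d032 : det3 (q 0) (q 3) (q 2) = affDep q 1 := by rw [s2, e1]; ring
    have d120 : det3 (q 1) (q 2) (q 0) = -affDep q 3 := by rw [s2, s1, e3]; ring
    have d130 : det3 (q 1) (q 3) (q 0) = affDep q 2 := by rw [s2, s1, e2]; ring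
    have d132 : det3 (q 1) (q 3) (q 2) = -affDep q 0 := by rw [s2, e0]
    have d230 : det3 (q 2) (q 3) (q 0) = -affDep q 1 := by rw [s2, s1, e1]; ring
    have d231 : det3 (q 2) (q 3) (q 1) = affDep q 0 := by rw [s2, s1, e0]; ring
    fin_cases i <;> fin_cases j <;> first | exact absurd hij (by decide) | skip
    all_goals
      simp [stressW, Finset.prod_filter, Fin.prod_univ_four]
      simp only [e0, e1, e2, e3, d021, d031, d032, d120, d130, d132, d230, d231]
      field_simp
  rcases lt_or_gt_of_ne hij with h | h
  · exact key i j h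
  · rw [stressW_comm, key j i h, mul_comm]

/-- Any dependence is a multiple of the areas, and the scalar enters squared. The signs of the
stress can therefore be read off from any dependence. -/
theorem IsAffDep.stressW_eq {q : Fin 4 → Plane} (hq : GeneralPosition q) {a : Fin 4 → ℝ}
    (h : IsAffDep q a) :
    ∃ κ : ℝ, 0 < κ ∧ ∀ i j, i ≠ j → stressW q i j = -(κ * (a i * a j * ∏ k, a k)) := by
  have hA := (isAffDep_affDep hq).ne_zero
  have hP : ∏ k, a k ≠ 0 := Finset.prod_ne_zero_iff.2 fun i _ => h.ne_zero i
  set μ := affDep q 0 / a 0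
  have hμ : μ ≠ 0 := div_ne_zero (hA 0) (h.ne_zero 0)
  have hmul : ∀ i, affDep q i = μ * a i := by
    intro i
    have := h.affDep_mul i
    have h0 := h.ne_zero 0
    simp only [μ]
    field_simp
    linarith
  refine ⟨1 / (μ * ∏ k, a k) ^ 2, by positivity, fun i j hij => ?_⟩
  have := stressW_mul_prod hq hij
  simp only [hmul, Finset.prod_mul_distrib, Finset.prod_const, Finset.card_univ,
    Fintype.card_fin] at this
  field_simp
  have h2 : μ ^ 2 * (stressW q i j * μ ^ 2 * ∏ k, a k) = μ ^ 2 * (-(a i * a j)) := by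
    linear_combination this
  exact mul_left_cancel₀ (pow_ne_zero 2 hμ) h2

/-! ### The stress of four points -/

theorem stressW_ne_zero {q : Fin 4 → Plane} (hq : GeneralPosition q) {i j : Fin 4} (hij : i ≠ j) :
    stressW q i j ≠ 0 := by
  intro h
  have := stressW_mul_prod hq hij
  rw [h, zero_mul] at this
  have hA := (isAffDep_affDep hq).ne_zero
  exact mul_ne_zero (hA i) (hA j) (by linarith)

/-- After the factor common to all `j` is taken out, what remains is `∑ j, a j • (q i - q j)`, which
vanishes for an affine dependence. -/
theorem sum_stressW_smul {q : Fin 4 → Plane} (hq : GeneralPosition q) (i : Fin 4) :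
    ∑ j, stressW q i j • (q i - q j) = 0 := by
  have ha := isAffDep_affDep hq
  obtain ⟨κ, -, hw⟩ := ha.stressW_eq hq
  have hterm : ∀ j, stressW q i j • (q i - q j) =
      (-(κ * (affDep q i * ∏ k, affDep q k))) • (affDep q j • q i - affDep q j • q j) := by
    intro j
    rcases eq_or_ne i j with rfl | hij
    · simp
    · rw [hw i j hij, ← smul_sub, smul_smul]
      congr 1
      ring
  rw [Finset.sum_congr rfl fun j _ => hterm j, ← Finset.smul_sum, Finset.sum_sub_distrib,
    ← Finset.sum_smul, ha.sum_eq, ha.sum_smul_eq]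
  simp

theorem stressα_eq (q : Fin 4 → Plane) (i : Fin 4) :
    stressα q i = ∑ j, stressW q i j * ‖q i - q j‖ := by
  rw [stressα, Finset.sum_filter]
  refine Finset.sum_congr rfl fun j _ => ?_
  split_ifs with h
  · rfl
  · push Not at h
    simp [h]

/-- By equilibrium the force along the edge to `l` balances all the others, so by the triangle
inequality its length is at most the sum of theirs. -/
theorem stressα_nonneg {q : Fin 4 → Plane} (hq : GeneralPosition q) {i l : Fin 4}
    (h : ∀ j, j ≠ l → 0 ≤ stressW q i j) : 0 ≤ stressα q i := by
  have hs := sum_stressW_smul hq i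
  rw [← Finset.add_sum_erase _ _ (Finset.mem_univ l)] at hs
  rw [stressα_eq, ← Finset.add_sum_erase _ _ (Finset.mem_univ l)]
  have h1 : ‖stressW q i l • (q i - q l)‖ ≤
      ∑ j ∈ Finset.univ.erase l, stressW q i j * ‖q i - q j‖ := by
    rw [eq_neg_of_add_eq_zero_left hs, norm_neg]
    refine (norm_sum_le _ _).trans (Finset.sum_le_sum fun j hj => ?_)
    rw [norm_smul, Real.norm_of_nonneg (h j (Finset.ne_of_mem_erase hj))]
  rw [norm_smul, Real.norm_eq_abs] at h1
  have h2 : -(|stressW q i l| * ‖q i - q l‖) ≤ stressW q i l * ‖q i - q l‖ := by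
    rw [← neg_mul]
    exact mul_le_mul_of_nonneg_right (neg_abs_le _) (norm_nonneg _)
  linarith

/-- The equilibrium condition at one of four points determines the stress there up to a scalar. -/
theorem mul_eq_mul_of_equilibrium {q : Fin 4 → Plane} (hq : GeneralPosition q) {i j k : Fin 4}
    {x y : Fin 4 → ℝ} (hx : ∑ j, x j • (q i - q j) = 0) (hy : ∑ j, y j • (q i - q j) = 0)
    (hij : i ≠ j) (hik : i ≠ k) : x j * y k = x k * y j := by
  rcases eq_or_ne j k with rfl | hjk
  · rfl
  obtain ⟨l, hil, hjl, hkl, hu⟩ : ∃ l, i ≠ l ∧ j ≠ l ∧ k ≠ l ∧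
      (Finset.univ : Finset (Fin 4)) = {i, j, k, l} := by
    have : ∀ i j k : Fin 4, i ≠ j ∧ i ≠ k ∧ j ≠ k → ∃ l, i ≠ l ∧ j ≠ l ∧ k ≠ l ∧
      (Finset.univ : Finset (Fin 4)) = {i, j, k, l} := by decide
    exact this i j k ⟨hij, hik, hjk⟩
  -- The cross product with `q l - q i` eliminates the term of `l`.
  have hcross : ∀ z : Fin 4 → ℝ, ∑ j, z j • (q i - q j) = 0 →
      z j * det3 (q i) (q j) (q l) + z k * det3 (q i) (q k) (q l) = 0 := by
    intro z hz
    rw [hu, Finset.sum_insert (by simp [hij, hik, hil]), Finset.sum_insert (by simp [hjk, hjl]),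
      Finset.sum_insert (by simp [hkl]), Finset.sum_singleton] at hz
    have h0 := congrArg (fun v : Plane => v 0) hz
    have h1 := congrArg (fun v : Plane => v 1) hz
    simp at h0 h1
    rw [det3_eq, det3_eq]
    linear_combination (-(q l 1 - q i 1)) * h0 + (q l 0 - q i 0) * h1
  have h1 := hcross x hx
  have h2 := hcross y hy
  have hD := hq.det3_ne_zero hij hil hjl
  apply mul_right_cancel₀ hD
  linear_combination y k * h1 - x k * h2

/-- The self-stresses of four points are the multiples of `stressW`. -/
theorem exists_eq_mul_stressW {q : Fin 4 → Plane} (hq : GeneralPosition q) {μ : Fin 4 → Fin 4 → ℝ}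
    (hsymm : ∀ i j, μ i j = μ j i) (hμ : ∀ i, ∑ j, μ i j • (q i - q j) = 0) :
    ∃ s : ℝ, ∀ i j, i ≠ j → μ i j = s * stressW q i j := by
  set m : Fin 4 → Fin 4 → ℝ := fun i j => μ i j / stressW q i j
  have hm : ∀ i j k, i ≠ j → i ≠ k → m i j = m i k := by
    intro i j k hij hik
    simp only [m]
    rw [div_eq_div_iff (stressW_ne_zero hq hij) (stressW_ne_zero hq hik)]
    exact mul_eq_mul_of_equilibrium hq (hμ i) (sum_stressW_smul hq i) hij hik
  have hm' : ∀ i j, m i j = m j i := by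
    intro i j
    simp only [m]
    rw [hsymm, stressW_comm]
  refine ⟨m 0 1, fun i j hij => ?_⟩
  have : m i j = m 0 1 := by
    rcases eq_or_ne i 0 with rfl | hi
    · exact hm 0 j 1 hij (by decide)
    · rw [hm i j 0 hij hi, hm' i 0, hm 0 i 1 hi.symm (by decide)]
  rw [← this]
  simp only [m]
  rw [div_mul_cancel₀ _ (stressW_ne_zero hq hij)]

/-! ### Crossings and non-pointed marked vertices -/

/-- The sign pattern of an affine dependence: Radon partitions have type (2, 2) or (1, 3). -/
theorem IsAffDep.sign_cases {q : Fin 4 → Plane} {a : Fin 4 → ℝ} (h : IsAffDep q a) :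
    (∃ i j k l, i ≠ j ∧ k ≠ l ∧ i ≠ k ∧ i ≠ l ∧ j ≠ k ∧ j ≠ l ∧
      (Finset.univ : Finset (Fin 4)) = {i, j, k, l} ∧ 0 < a i ∧ 0 < a j ∧ a k < 0 ∧ a l < 0) ∨
    ∃ i, ∀ j, j ≠ i → a i * a j < 0 := by
  classical
  set S : Finset (Fin 4) := Finset.univ.filter fun i => 0 < a i
  have hS : ∀ i, i ∈ S ↔ 0 < a i := fun i => by simp [S]
  have hSc : ∀ i, i ∈ Sᶜ ↔ a i < 0 := fun i => by
    rw [Finset.mem_compl, hS, not_lt]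
    exact ⟨fun h' => lt_of_le_of_ne h' (h.ne_zero i), le_of_lt⟩
  have hcard : S.card + Sᶜ.card = 4 := Finset.card_add_card_compl S
  have hsum := h.sum_eq
  have hS0 : S.card ≠ 0 := by
    intro h0
    have : ∀ i, a i < 0 := fun i => (hSc i).1 (by simp [Finset.card_eq_zero.1 h0])
    have := Finset.sum_neg (s := Finset.univ) (f := a) (fun i _ => this i) ⟨0, by simp⟩
    linarith
  have hSc0 : Sᶜ.card ≠ 0 := by
    intro h0
    have h1 : Sᶜ = ∅ := Finset.card_eq_zero.1 h0
    have : ∀ i, 0 < a i := fun i => by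
      rw [← hS]
      by_contra hi
      have : i ∈ Sᶜ := Finset.mem_compl.2 hi
      rw [h1] at this
      simp at this
    have := Finset.sum_pos (s := Finset.univ) (f := a) (fun i _ => this i) ⟨0, by simp⟩
    linarith
  have hcases : S.card = 1 ∨ S.card = 2 ∨ Sᶜ.card = 1 := by omega
  rcases hcases with h1 | h2 | h3
  · right
    obtain ⟨i, hi⟩ := Finset.card_eq_one.1 h1
    refine ⟨i, fun j hj => mul_neg_of_pos_of_neg ((hS i).1 (by simp [hi])) ((hSc j).1 ?_)⟩
    simp [hi, hj]
  · left
    obtain ⟨i, j, hij, hi⟩ := Finset.card_eq_two.1 h2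
    obtain ⟨k, l, hkl, hk⟩ := Finset.card_eq_two.1 (show Sᶜ.card = 2 by omega)
    have pi := (hS i).1 (by simp [hi])
    have pj := (hS j).1 (by simp [hi])
    have pk := (hSc k).1 (by simp [hk])
    have pl := (hSc l).1 (by simp [hk])
    refine ⟨i, j, k, l, hij, hkl, ?_, ?_, ?_, ?_, ?_, pi, pj, pk, pl⟩
    · rintro rfl; linarith
    · rintro rfl; linarith
    · rintro rfl; linarith
    · rintro rfl; linarith
    · rw [← Finset.union_compl S, hk, hi]
      ext
      simp
      tauto
  · right
    obtain ⟨i, hi⟩ := Finset.card_eq_one.1 h3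
    refine ⟨i, fun j hj => mul_neg_of_neg_of_pos ((hSc i).1 (by simp [hi])) ((hS j).1 ?_)⟩
    rw [← Finset.notMem_compl, hi]
    simpa using hj

/-- A graph that contains all edges and marks on which the stress of four points is negative has
a crossing. -/
theorem MarkedGraph.not_nonCrossing {n : ℕ} {p : Fin n → Plane} (hp : GeneralPosition p)
    {T : MarkedGraph n} (σ : Fin 4 ↪ Fin n)
    (hE : ∀ i j, stressW (p ∘ σ) i j < 0 → T.graph.Adj (σ i) (σ j))
    (hM : ∀ i, stressα (p ∘ σ) i < 0 → σ i ∈ T.marks) : ¬ T.NonCrossing p := by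
  rintro ⟨hplane, hpointed⟩
  have hq := hp.comp σ
  have ha := isAffDep_affDep hq
  obtain ⟨κ, hκ, hw⟩ := ha.stressW_eq hq
  set q := p ∘ σ with hqdef
  set a := affDep q
  rcases ha.sign_cases with ⟨i, j, k, l, hij, hkl, hik, hil, hjk, hjl, hu, hi, hj, hk, hl⟩ | ⟨i, hi⟩
  · have expand : ∀ {M : Type} [AddCommMonoid M] (g : Fin 4 → M),
        ∑ x, g x = g i + (g j + (g k + g l)) := by
      intro M _ g
      rw [hu, Finset.sum_insert (by simp [hij, hik, hil]), Finset.sum_insert (by simp [hjk, hjl]),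
        Finset.sum_insert (by simp [hkl]), Finset.sum_singleton]
    have hP : ∏ x, a x = a i * (a j * (a k * a l)) := by
      rw [hu, Finset.prod_insert (by simp [hij, hik, hil]), Finset.prod_insert (by simp [hjk, hjl]),
        Finset.prod_insert (by simp [hkl]), Finset.prod_singleton]
    have hkl' := mul_pos_of_neg_of_neg hk hl
    have hPpos : 0 < ∏ x, a x := by
      rw [hP]
      positivity
    have hadj1 : T.graph.Adj (σ i) (σ j) := hE i j (by
      rw [hw i j hij]
      have : 0 < κ * (a i * a j * ∏ x, a x) := by positivity
      linarith)
    have hadj2 : T.graph.Adj (σ k) (σ l) := hE k l (by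
      rw [hw k l hkl]
      have : 0 < κ * (a k * a l * ∏ x, a x) := by positivity
      linarith)
    have hs := ha.sum_eq
    have hv := ha.sum_smul_eq
    rw [expand] at hs hv
    have hpos : 0 < a i + a j := by linarith
    -- This is the Radon point, where the two diagonals cross.
    have hz1 : (a i + a j)⁻¹ • (a i • q i + a j • q j) ∈ segment ℝ (q i) (q j) := by
      refine ⟨(a i + a j)⁻¹ * a i, (a i + a j)⁻¹ * a j, by positivity, by positivity, ?_, ?_⟩
      · field_simp
      · rw [smul_add, smul_smul, smul_smul]
    have hz2 : (a i + a j)⁻¹ • (a i • q i + a j • q j) ∈ segment ℝ (q k) (q l) := by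
      have hk' : 0 ≤ -a k := by linarith
      have hl' : 0 ≤ -a l := by linarith
      refine ⟨(a i + a j)⁻¹ * -a k, (a i + a j)⁻¹ * -a l, by positivity, by positivity, ?_, ?_⟩
      · field_simp
        linarith
      · rw [mul_smul, mul_smul, ← smul_add]
        congr 1
        rw [← add_assoc] at hv
        rw [eq_neg_of_add_eq_zero_left hv]
        simp only [neg_smul]
        abel
    have hne : s(σ i, σ j) ≠ s(σ k, σ l) := by
      simp [σ.injective.eq_iff, hik, hil]
    have hz := hplane _ _ _ _ hadj1 hadj2 hne ⟨hz1, hz2⟩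
    simp only [Set.mem_inter_iff, Set.mem_insert_iff, Set.mem_singleton_iff] at hz
    have hinj : ∀ x y : Fin 4, x ≠ y → p (σ x) ≠ p (σ y) := fun x y hxy => hq.1.ne hxy
    rcases hz with ⟨h1 | h1, h2 | h2⟩
    · exact hinj i k hik (h1.symm.trans h2)
    · exact hinj i l hil (h1.symm.trans h2)
    · exact hinj j k hjk (h1.symm.trans h2)
    · exact hinj j l hjl (h1.symm.trans h2)
  · have hPneg : ∏ x, a x < 0 := by
      have key : ∀ i : Fin 4, ∃ j k l, j ≠ i ∧ k ≠ i ∧ l ≠ i ∧ j ≠ k ∧ j ≠ l ∧ k ≠ l ∧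
          (Finset.univ : Finset (Fin 4)) = {i, j, k, l} := by decide
      obtain ⟨j, k, l, hji, hki, hli, hjk, hjl, hkl, hu⟩ := key i
      have hP : ∏ x, a x = a i * (a j * (a k * a l)) := by
        rw [hu, Finset.prod_insert (by simp [hji.symm, hki.symm, hli.symm]),
          Finset.prod_insert (by simp [hjk, hjl]), Finset.prod_insert (by simp [hkl]),
          Finset.prod_singleton]
      have h3 := mul_neg_of_pos_of_neg (mul_pos_of_neg_of_neg (hi j hji) (hi k hki)) (hi l hli)
      by_contra hneg
      push Not at hneg
      have := mul_nonneg (sq_nonneg (a i)) hneg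
      rw [hP] at this
      nlinarith
    have hwneg : ∀ j, j ≠ i → stressW q i j < 0 := by
      intro j hj
      rw [hw i j hj.symm]
      have := mul_pos hκ (mul_pos_of_neg_of_neg (hi j hj) hPneg)
      linarith
    have hαneg : stressα q i < 0 := by
      rw [stressα]
      refine Finset.sum_neg (fun j hj => ?_) ?_
      · have hj' : j ≠ i := (Finset.mem_filter.1 hj).2
        exact mul_neg_of_neg_of_pos (hwneg j hj') (norm_pos_iff.2 (sub_ne_zero.2 (hq.1.ne hj'.symm)))
      · obtain ⟨j, hj⟩ := exists_ne i
        exact ⟨j, by simpa using hj⟩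
    obtain ⟨u, hu⟩ := hpointed _ (hM i hαneg)
    -- Paired with a vector `u` witnessing pointedness, every term of the equilibrium at `i` becomes
    -- positive, so the sum cannot vanish.
    have hs := congrArg (fun z => ⟪u, z⟫_ℝ) (sum_stressW_smul hq i)
    simp only [inner_sum, inner_smul_right, inner_zero_right] at hs
    have hterm : ∀ j, j ≠ i → 0 < stressW q i j * ⟪u, q i - q j⟫_ℝ := by
      intro j hj
      have := hu _ (hE i j (hwneg j hj))
      rw [← neg_sub, inner_neg_right] at this
      exact mul_pos_of_neg_of_neg (hwneg j hj) (by
        change ⟪u, p (σ i) - p (σ j)⟫_ℝ < 0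
        linarith)
    have := Finset.sum_pos' (s := Finset.univ) (f := fun j => stressW q i j * ⟪u, q i - q j⟫_ℝ)
      (fun j _ => by
        rcases eq_or_ne j i with rfl | hj
        · simp
        · exact (hterm j hj).le)
      (by
        obtain ⟨j, hj⟩ := exists_ne i
        exact ⟨j, Finset.mem_univ _, hterm j hj⟩)
    linarith

/-- Four points in the position of a crossing. -/
theorem stress_signs_of_crossing {q : Fin 4 → Plane} (hq : GeneralPosition q) {a : Fin 4 → ℝ}
    (ha : IsAffDep q a) (h0 : 0 < a 0) (h1 : 0 < a 1) (h2 : a 2 < 0) (h3 : a 3 < 0) :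
    (∀ i j, stressW q i j < 0 → j = (![1, 0, 3, 2] : Fin 4 → Fin 4) i) ∧
      ∀ i, 0 ≤ stressα q i := by
  obtain ⟨κ, hκ, hw⟩ := ha.stressW_eq hq
  have hP : 0 < ∏ x, a x := by
    rw [Fin.prod_univ_four]
    exact mul_pos_of_neg_of_neg (mul_neg_of_pos_of_neg (mul_pos h0 h1) h2) h3
  -- The vector `![1, 0, 3, 2]` sends each point to the other end of its diagonal.
  have hnonneg : ∀ i j, j ≠ (![1, 0, 3, 2] : Fin 4 → Fin 4) i → 0 ≤ stressW q i j := by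
    intro i j hj
    rcases eq_or_ne i j with rfl | hij
    · rw [stressW_self]
    rw [hw i j hij]
    have : a i * a j < 0 := by
      fin_cases i <;> fin_cases j <;> first | exact absurd rfl hij | exact absurd rfl hj | skip
      all_goals
        first
        | exact mul_neg_of_pos_of_neg (by assumption) (by assumption)
        | exact mul_neg_of_neg_of_pos (by assumption) (by assumption)
    have := mul_neg_of_pos_of_neg hκ (mul_neg_of_neg_of_pos this hP)
    linarith
  refine ⟨fun i j hij => ?_, fun i => stressα_nonneg hq (hnonneg i)⟩
  by_contra h
  exact absurd (hnonneg i j h) (not_le.2 hij)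

/-- Four points, the first of which lies inside the triangle of the others. -/
theorem stress_signs_of_interior {q : Fin 4 → Plane} (hq : GeneralPosition q) {a : Fin 4 → ℝ}
    (ha : IsAffDep q a) (h0 : a 0 < 0) (hpos : ∀ i, i ≠ 0 → 0 < a i) :
    (∀ i j, stressW q i j < 0 → i = 0 ∨ j = 0) ∧ ∀ i, stressα q i < 0 → i = 0 := by
  obtain ⟨κ, hκ, hw⟩ := ha.stressW_eq hq
  have hP : ∏ x, a x < 0 := by
    rw [Fin.prod_univ_four]
    exact mul_neg_of_neg_of_pos (mul_neg_of_neg_of_pos (mul_neg_of_neg_of_pos h0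
      (hpos 1 (by decide))) (hpos 2 (by decide))) (hpos 3 (by decide))
  have hnonneg : ∀ i j, i ≠ 0 → j ≠ 0 → 0 ≤ stressW q i j := by
    intro i j hi hj
    rcases eq_or_ne i j with rfl | hij
    · rw [stressW_self]
    rw [hw i j hij]
    have := mul_neg_of_pos_of_neg hκ (mul_neg_of_pos_of_neg (mul_pos (hpos i hi) (hpos j hj)) hP)
    linarith
  refine ⟨fun i j hij => ?_, fun i hi => ?_⟩
  · by_contra h
    push Not at h
    exact absurd (hnonneg i j h.1 h.2) (not_le.2 hij)
  · by_contra h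
    exact absurd (stressα_nonneg hq fun j hj => hnonneg i j h hj) (not_le.2 hi)

theorem det3_eq_zero_of_segment {q₁ q₂ q₃ : Plane} {s r : ℝ} (hsr : s + r = 1)
    (h : q₁ = s • q₂ + r • q₃) : det3 q₁ q₂ q₃ = 0 := by
  have h0 := congrArg (fun z : Plane => z 0) h
  have h1 := congrArg (fun z : Plane => z 1) h
  simp at h0 h1
  obtain rfl : s = 1 - r := by linarith
  rw [det3_eq, h0, h1]
  ring

/-- Two segments from a common end-point to two other points meet in that end-point only. -/
theorem eq_of_mem_segments {q₁ q₂ q₃ z : Plane} (hd : det3 q₁ q₂ q₃ ≠ 0)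
    (h2 : z ∈ segment ℝ q₁ q₂) (h3 : z ∈ segment ℝ q₁ q₃) : z = q₁ := by
  obtain ⟨s, r, -, -, hsr, rfl⟩ := h2
  obtain ⟨s', r', -, -, hsr', h⟩ := h3
  have h0 := congrArg (fun z : Plane => z 0) h
  have h1 := congrArg (fun z : Plane => z 1) h
  simp at h0 h1
  obtain rfl : s = 1 - r := by linarith
  obtain rfl : s' = 1 - r' := by linarith
  have hr : r = 0 := by
    rw [det3_eq] at hd
    have : r * ((q₂ 0 - q₁ 0) * (q₃ 1 - q₁ 1) - (q₃ 0 - q₁ 0) * (q₂ 1 - q₁ 1)) = 0 := by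
      linear_combination -(q₃ 1 - q₁ 1) * h0 + (q₃ 0 - q₁ 0) * h1
    exact (mul_eq_zero.1 this).resolve_right hd
  simp [hr]

/-- Two crossing edges give four points all of whose negative stresses are on those edges. -/
theorem exists_stress_of_crossing {n : ℕ} {p : Fin n → Plane} (hp : GeneralPosition p)
    {T : MarkedGraph n} (h : ¬ PlaneDrawing p T.graph) :
    ∃ σ : Fin 4 ↪ Fin n, (∀ i j, stressW (p ∘ σ) i j < 0 → T.graph.Adj (σ i) (σ j)) ∧
      ∀ i, stressα (p ∘ σ) i < 0 → σ i ∈ T.marks := by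
  simp only [PlaneDrawing, not_forall] at h
  obtain ⟨i, j, k, l, hij, hkl, hne, hsub⟩ := h
  obtain ⟨z, ⟨hz1, hz2⟩, hz⟩ := Set.not_subset.1 hsub
  have share : ∀ {i j l : Fin n}, T.graph.Adj i j → T.graph.Adj i l → j ≠ l →
      z ∈ segment ℝ (p i) (p j) → z ∈ segment ℝ (p i) (p l) → z = p i :=
    fun hj hl hjl h2 h3 => eq_of_mem_segments (hp.det3_ne_zero hj.ne hl.ne hjl) h2 h3
  have hik : i ≠ k := by
    rintro rfl
    have := share hij hkl (by rintro rfl; exact hne rfl) hz1 hz2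
    exact hz (by simp [this])
  have hil : i ≠ l := by
    rintro rfl
    rw [segment_symm] at hz2
    have := share hij hkl.symm (by rintro rfl; exact hne Sym2.eq_swap) hz1 hz2
    exact hz (by simp [this])
  have hjk : j ≠ k := by
    rintro rfl
    rw [segment_symm] at hz1
    have := share hij.symm hkl (by rintro rfl; exact hne Sym2.eq_swap) hz1 hz2
    exact hz (by simp [this])
  have hjl : j ≠ l := by
    rintro rfl
    rw [segment_symm] at hz1 hz2
    have := share hij.symm hkl.symm (by rintro rfl; exact hne rfl) hz1 hz2
    exact hz (by simp [this])
  obtain ⟨s, r, hs, hr, hsr, hz1⟩ := hz1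
  obtain ⟨s', r', hs', hr', hsr', hz2⟩ := hz2
  have hz := hz1.trans hz2.symm
  -- A vanishing coefficient would put an end-point of one segment on the other, making three points
  -- collinear.
  have ne_zero : ∀ {s r s' r' : ℝ} {i j k l : Fin n}, s + r = 1 → s' + r' = 1 →
      s • p i + r • p j = s' • p k + r' • p l → j ≠ k → j ≠ l → k ≠ l → s ≠ 0 := by
    rintro s r s' r' i j k l hsr hsr' h hjk hjl hkl rfl
    obtain rfl : r = 1 := by linarith
    rw [zero_smul, zero_add, one_smul] at h
    exact hp.det3_ne_zero hjk hjl hkl (det3_eq_zero_of_segment hsr' h)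
  have s0 : 0 < s := hs.lt_of_ne' (ne_zero hsr hsr' hz hjk hjl hkl.ne)
  have r0 : 0 < r := hr.lt_of_ne' (ne_zero ((add_comm _ _).trans hsr) hsr' (by rw [add_comm, hz]) hik hil hkl.ne)
  have s0' : 0 < s' := hs'.lt_of_ne' (ne_zero hsr' hsr hz.symm hil.symm hjl.symm hij.ne)
  have r0' : 0 < r' :=
    hr'.lt_of_ne' (ne_zero ((add_comm _ _).trans hsr') hsr (by rw [add_comm, ← hz]) hik.symm hjk.symm hij.ne)
  have hinj : Function.Injective ![i, j, k, l] := by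
    intro x y
    fin_cases x <;> fin_cases y <;>
      simp [hij.ne, hij.ne.symm, hkl.ne, hkl.ne.symm, hik, hik.symm, hil, hil.symm, hjk, hjk.symm,
        hjl, hjl.symm]
  let σ : Fin 4 ↪ Fin n := ⟨![i, j, k, l], hinj⟩
  have ha : IsAffDep (p ∘ σ) ![s, r, -s', -r'] := by
    refine ⟨fun x => ?_, ?_, ?_⟩
    · fin_cases x
      exacts [s0.ne', r0.ne', neg_ne_zero.2 s0'.ne', neg_ne_zero.2 r0'.ne']
    · simp [Fin.sum_univ_four]
      linarith
    · rw [Fin.sum_univ_four]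
      change s • p i + r • p j + -s' • p k + -r' • p l = 0
      rw [hz]
      simp only [neg_smul]
      abel
  obtain ⟨hw, hα⟩ := stress_signs_of_crossing (hp.comp σ) ha s0 r0 (neg_neg_of_pos s0')
    (neg_neg_of_pos r0')
  refine ⟨σ, fun x y hxy => ?_, fun x hx => absurd (hα x) (not_le.2 hx)⟩
  rw [hw x y hxy]
  fin_cases x
  exacts [hij, hij.symm, hkl, hkl.symm]

/-- A non-pointed vertex is a positive combination of some of its neighbours. -/
theorem zero_mem_convexHull_of_not_pointed {n : ℕ} {p : Fin n → Plane} {G : SimpleGraph (Fin n)}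
    {i : Fin n} (h : ¬ Pointed p G i) :
    (0 : Plane) ∈ convexHull ℝ ((fun j => p j - p i) '' {j | G.Adj i j}) := by
  by_contra h0
  -- The hull of finitely many directions is closed; a functional separating it from `0` is the
  -- inner product with a vector proving pointedness.
  obtain ⟨g, u, hg0, hg⟩ := geometric_hahn_banach_point_closed (convex_convexHull ℝ _)
    ((Set.toFinite ((fun j => p j - p i) '' {j | G.Adj i j})).isClosed_convexHull ℝ) h0
  refine h ⟨(InnerProductSpace.toDual ℝ Plane).symm g, fun j hj => ?_⟩
  rw [InnerProductSpace.toDual_symm_apply]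
  rw [map_zero] at hg0
  exact hg0.trans (hg _ (subset_convexHull ℝ _ ⟨j, hj, rfl⟩))

/-- Carathéodory's theorem gives at most three neighbours. One neighbour would coincide with `p i`,
and two would be collinear with it, so there are exactly three. -/
theorem exists_triangle_of_not_pointed {n : ℕ} {p : Fin n → Plane} (hp : GeneralPosition p)
    {G : SimpleGraph (Fin n)} {i : Fin n} (h : ¬ Pointed p G i) :
    ∃ (J : Fin 3 → Fin n) (w : Fin 3 → ℝ), Function.Injective J ∧ (∀ m, G.Adj i (J m)) ∧
      (∀ m, 0 < w m) ∧ ∑ m, w m • (p (J m) - p i) = 0 := by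
  obtain ⟨ι, _, z, w, hz, hind, hw, hsum, hcomb⟩ :=
    eq_pos_convex_span_of_mem_convexHull (zero_mem_convexHull_of_not_pointed h)
  have hJ : ∀ m, ∃ j, G.Adj i j ∧ p j - p i = z m := fun m => by
    obtain ⟨j, hj, hjz⟩ := hz ⟨m, rfl⟩
    exact ⟨j, hj, hjz⟩
  choose J hJadj hJz using hJ
  have hJinj : Function.Injective J := fun m m' hm => hind.injective (by rw [← hJz, ← hJz, hm])
  have hcard : Fintype.card ι ≤ 3 := by
    have h1 := hind.card_le_finrank_succ
    have h2 := Submodule.finrank_le (vectorSpan ℝ (Set.range z))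
    rw [finrank_euclideanSpace_fin] at h2
    omega
  obtain ⟨c, hc⟩ : ∃ c, Fintype.card ι = c := ⟨_, rfl⟩
  rw [hc] at hcard
  obtain ⟨e⟩ : Nonempty (Fin c ≃ ι) := ⟨(Fintype.equivFinOfCardEq hc).symm⟩
  have hcomb' : ∑ m : Fin c, w (e m) • (p (J (e m)) - p i) = 0 := by
    rw [← hcomb, ← e.sum_comp]
    simp only [hJz]
  have hsum' : ∑ m : Fin c, w (e m) = 1 := by rw [← hsum, ← e.sum_comp]
  clear hc
  interval_cases c
  · simp at hsum'
  · rw [Fin.sum_univ_one] at hsum' hcomb'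
    rw [hsum', one_smul, sub_eq_zero] at hcomb'
    exact absurd (hp.1 hcomb') (hJadj _).ne'
  · rw [Fin.sum_univ_two] at hsum' hcomb'
    refine absurd (det3_eq_zero_of_segment hsum' ?_) (hp.det3_ne_zero (hJadj (e 0)).ne
      (hJadj (e 1)).ne (hJinj.ne (e.injective.ne zero_ne_one)))
    have : p i = (w (e 0) + w (e 1)) • p i := by rw [hsum', one_smul]
    rw [this, add_smul, ← sub_eq_zero, ← neg_eq_zero, ← hcomb', smul_sub, smul_sub]
    abel
  · exact ⟨J ∘ e, w ∘ e, hJinj.comp e.injective, fun m => hJadj _, fun m => hw _, hcomb'⟩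

/-- A non-pointed marked vertex gives four points all of whose negative stresses are on it and its
edges. -/
theorem exists_stress_of_not_pointed {n : ℕ} {p : Fin n → Plane} (hp : GeneralPosition p)
    {T : MarkedGraph n} {i : Fin n} (hi : i ∈ T.marks) (h : ¬ Pointed p T.graph i) :
    ∃ σ : Fin 4 ↪ Fin n, (∀ i j, stressW (p ∘ σ) i j < 0 → T.graph.Adj (σ i) (σ j)) ∧
      ∀ i, stressα (p ∘ σ) i < 0 → σ i ∈ T.marks := by
  obtain ⟨J, w, hJ, hadj, hw, hcomb⟩ := exists_triangle_of_not_pointed hp h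
  let σ : Fin 4 ↪ Fin n := ⟨Fin.cons i J, Fin.cons_injective_iff.2
    ⟨by rintro ⟨m, rfl⟩; exact (hadj m).ne rfl, hJ⟩⟩
  have hpos : ∀ x, x ≠ 0 → 0 < (Fin.cons (-∑ m, w m) w : Fin 4 → ℝ) x := by
    intro x hx
    obtain ⟨m, rfl⟩ := Fin.exists_succ_eq.2 hx
    exact hw m
  have h0 : -∑ m, w m < 0 := by
    rw [neg_lt_zero]
    exact Finset.sum_pos (fun m _ => hw m) ⟨0, by simp⟩
  have ha : IsAffDep (p ∘ σ) (Fin.cons (-∑ m, w m) w) := by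
    refine ⟨fun x => ?_, ?_, ?_⟩
    · rcases eq_or_ne x 0 with rfl | hx
      exacts [h0.ne, (hpos x hx).ne']
    · rw [Fin.sum_univ_succ]
      simp
    · rw [Fin.sum_univ_succ]
      change (-∑ m, w m) • p i + ∑ m, w m • p (J m) = 0
      rw [← hcomb, neg_smul, Finset.sum_smul, ← sub_eq_neg_add, ← Finset.sum_sub_distrib]
      simp only [smul_sub]
  obtain ⟨h1, h2⟩ := stress_signs_of_interior (hp.comp σ) ha h0 hpos
  have hadj' : ∀ y : Fin 4, y ≠ 0 → T.graph.Adj i (σ y) := by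
    intro y hy
    obtain ⟨m, rfl⟩ := Fin.exists_succ_eq.2 hy
    exact hadj m
  refine ⟨σ, fun x y hxy => ?_, fun x hx => ?_⟩
  · have hne : x ≠ y := by
      rintro rfl
      rw [stressW_self] at hxy
      exact lt_irrefl _ hxy
    rcases h1 x y hxy with rfl | rfl
    · exact hadj' y hne.symm
    · exact (hadj' x hne).symm
  · rw [h2 x hx]
    exact hi

/-- A marked graph that is not non-crossing contains all edges and marks on which the stress of
some four points is negative. -/
theorem MarkedGraph.exists_stress_of_not_nonCrossing {n : ℕ} {p : Fin n → Plane}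
    (hp : GeneralPosition p) {T : MarkedGraph n} (h : ¬ T.NonCrossing p) :
    ∃ σ : Fin 4 ↪ Fin n, (∀ i j, stressW (p ∘ σ) i j < 0 → T.graph.Adj (σ i) (σ j)) ∧
      ∀ i, stressα (p ∘ σ) i < 0 → σ i ∈ T.marks := by
  rw [MarkedGraph.NonCrossing, not_and_or] at h
  rcases h with h | h
  · exact exists_stress_of_crossing hp h
  · push Not at h
    obtain ⟨i, hi, hi'⟩ := h
    exact exists_stress_of_not_pointed hp hi hi'

/-! ### The constraints as linear forms -/

/-- `edgeForm` as a linear map. -/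
noncomputable def edgeFormL {n : ℕ} (p : Fin n → Plane) (i j : Fin n) : Motion n →ₗ[ℝ] ℝ where
  toFun x := edgeForm p x i j
  map_add' x y := by
    simp only [edgeForm, Prod.fst_add, Prod.snd_add, Pi.add_apply, inner_sub_right, inner_add_right]
    ring
  map_smul' r x := by
    simp only [edgeForm, Prod.smul_fst, Prod.smul_snd, Pi.smul_apply, inner_sub_right,
      real_inner_smul_right, smul_eq_mul, RingHom.id_apply]
    ring

/-- The coordinate `t_j` as a linear map. -/
noncomputable def markFormL {n : ℕ} (j : Fin n) : Motion n →ₗ[ℝ] ℝ :=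
  LinearMap.proj j ∘ₗ LinearMap.snd ℝ (Fin n → Plane) (Fin n → ℝ)

/-- All constraint forms, those of pairs and those of points. -/
noncomputable def constraintForm {n : ℕ} (p : Fin n → Plane) :
    (Fin n × Fin n) ⊕ Fin n → Motion n →ₗ[ℝ] ℝ :=
  Sum.elim (fun e => edgeFormL p e.1 e.2) markFormL

/-- The bounds of the constraint forms. The bound on the diagonal is never attained. -/
noncomputable def constraintBound {n : ℕ} (f : Params n) : (Fin n × Fin n) ⊕ Fin n → ℝ :=
  Sum.elim (fun e => if e.1 = e.2 then -1 else f.edge e.1 e.2) f.vertex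

theorem edgeForm_self {n : ℕ} (p : Fin n → Plane) (x : Motion n) (i : Fin n) :
    edgeForm p x i i = 0 := by
  simp [edgeForm]

theorem constraints_iff {n : ℕ} (p : Fin n → Plane) (f : Params n) (x : Motion n) :
    (∀ e, constraintBound f e ≤ constraintForm p e x) ↔
      (∀ i j : Fin n, i ≠ j → f.edge i j ≤ edgeForm p x i j) ∧ ∀ j, f.vertex j ≤ x.2 j := by
  rw [Sum.forall]
  refine and_congr ⟨fun h i j hij => ?_, fun h => ?_⟩ Iff.rfl
  · have := h (i, j)
    simp only [constraintBound, Sum.elim_inl, if_neg hij] at this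
    exact this
  · rintro ⟨i, j⟩
    simp only [constraintBound, constraintForm, Sum.elim_inl]
    split_ifs with hij
    · subst hij
      change -1 ≤ edgeForm p x i i
      rw [edgeForm_self]
      norm_num
    · exact h i j hij

theorem inner_plane (u v : Plane) : ⟪u, v⟫_ℝ = u 0 * v 0 + u 1 * v 1 := by
  simp [PiLp.inner_apply, Fin.sum_univ_two]
  ring

/-- Every motion can be normalized by a translation and an infinitesimal rotation. -/
theorem exists_normalized {n : ℕ} {p : Fin n → Plane} {a b : Fin n} (hab : p a 1 ≠ p b 1)
    (x : Motion n) :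
    ∃ z ∈ normalized a b, (∀ i j, edgeForm p z i j = edgeForm p x i j) ∧ z.2 = x.2 := by
  have hab' : p b 1 - p a 1 ≠ 0 := sub_ne_zero.2 hab.symm
  -- The angular velocity that cancels the first coordinate of the velocity of `b` relative to `a`.
  set ω := (x.1 b 0 - x.1 a 0) / (p b 1 - p a 1) with hω
  refine ⟨(fun i => x.1 i - x.1 a + ω • !₂[-(p i 1 - p a 1), p i 0 - p a 0], x.2),
    ⟨?_, ?_, ?_⟩, fun i j => ?_, rfl⟩
  · simp
  · simp
  · simp [hω]
    field_simp
    ring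
  · simp only [edgeForm, inner_plane]
    simp
    ring

/-- Once `t` is large enough for the marks, a fast dilation `v i = K • p i` satisfies the edge
constraints, since it contributes `K * ‖p i - p j‖ ^ 2`. -/
theorem exists_constraints {n : ℕ} {p : Fin n → Plane} (hp : GeneralPosition p) (f : Params n) :
    ∃ x : Motion n, (∀ i j : Fin n, i ≠ j → f.edge i j ≤ edgeForm p x i j) ∧
      ∀ j, f.vertex j ≤ x.2 j := by
  obtain ⟨τ, hτ⟩ := Finite.exists_le f.vertex
  obtain ⟨K, hK⟩ := Finite.exists_le fun e : Fin n × Fin n =>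
    (f.edge e.1 e.2 + ‖p e.1 - p e.2‖ * (τ + τ)) / ‖p e.1 - p e.2‖ ^ 2
  refine ⟨(fun i => K • p i, fun _ => τ), fun i j hij => ?_, hτ⟩
  have hpos : 0 < ‖p i - p j‖ := norm_pos_iff.2 (sub_ne_zero.2 (hp.1.ne hij))
  have := hK (i, j)
  rw [div_le_iff₀ (by positivity)] at this
  simp only [edgeForm, ← smul_sub, real_inner_smul_right, real_inner_self_eq_norm_sq]
  linarith

theorem convex_polyhedron {n : ℕ} (p : Fin n → Plane) (a b : Fin n) (f : Params n) :
    Convex ℝ (polyhedron p a b f) := by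
  rintro x ⟨⟨hx1, hx2, hx3⟩, hxc⟩ y ⟨⟨hy1, hy2, hy3⟩, hyc⟩ s r hs hr hsr
  rw [← constraints_iff] at hxc hyc
  refine ⟨⟨?_, ?_, ?_⟩, (constraints_iff p f _).1 fun e => ?_⟩
  · simp [hx1, hy1]
  · simp [hx2, hy2]
  · simp [hx3, hy3]
  · rw [map_add, map_smul, map_smul, smul_eq_mul, smul_eq_mul]
    obtain rfl : s = 1 - r := by linarith
    nlinarith [mul_le_mul_of_nonneg_left (hxc e) hs, mul_le_mul_of_nonneg_left (hyc e) hr]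

/-! ### Stresses -/

/-- Regrouping by end-points: `v i` is paired with the resultant force at `i`. The factor 2 arises
because the sum runs over ordered pairs. -/
theorem sum_mul_edgeForm {n : ℕ} (p : Fin n → Plane) {y : Fin n → Fin n → ℝ}
    (hy : ∀ i j, y i j = y j i) (x : Motion n) :
    ∑ i, ∑ j, y i j * edgeForm p x i j =
      2 * ∑ i, (⟪∑ j, y i j • (p i - p j), x.1 i⟫_ℝ - (∑ j, y i j * ‖p i - p j‖) * x.2 i) := by
  set g : Fin n → Fin n → ℝ := fun i j =>
    y i j * (⟪p i - p j, x.1 i⟫_ℝ - ‖p i - p j‖ * x.2 i) with hg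
  have h1 : ∀ i j, y i j * edgeForm p x i j = g i j + g j i := by
    intro i j
    simp only [hg]
    rw [hy j i, norm_sub_rev (p j), ← neg_sub (p i) (p j), inner_neg_left, edgeForm,
      inner_sub_right]
    ring
  have h2 : ∑ i, ∑ j, g j i = ∑ i, ∑ j, g i j := Finset.sum_comm
  simp only [h1, Finset.sum_add_distrib]
  rw [h2, two_mul]
  have h3 : ∀ i, ∑ j, g i j =
      ⟪∑ j, y i j • (p i - p j), x.1 i⟫_ℝ - (∑ j, y i j * ‖p i - p j‖) * x.2 i := by
    intro i
    simp only [hg]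
    rw [sum_inner, Finset.sum_mul, ← Finset.sum_sub_distrib]
    refine Finset.sum_congr rfl fun j _ => ?_
    rw [real_inner_smul_left]
    ring
  simp only [h3]

/-- The equilibrium conditions of a stress. -/
theorem equilibrium_of_sum_eq_zero {n : ℕ} {p : Fin n → Plane} {y : Fin n → Fin n → ℝ}
    {m : Fin n → ℝ} (hy : ∀ i j, y i j = y j i)
    (h : ∀ x : Motion n, ∑ i, ∑ j, y i j * edgeForm p x i j + ∑ j, m j * x.2 j = 0) (i : Fin n) :
    ∑ j, y i j • (p i - p j) = 0 ∧ m i = 2 * ∑ j, y i j * ‖p i - p j‖ := by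
  classical
  simp only [sum_mul_edgeForm p hy] at h
  constructor
  · have := h (Pi.single i (∑ j, y i j • (p i - p j)), 0)
    rw [Finset.sum_eq_single_of_mem i (Finset.mem_univ i)
      (fun k _ hk => by simp [Pi.single_eq_of_ne hk])] at this
    simpa using this
  · have := h (0, Pi.single i 1)
    simp [Pi.single_apply] at this
    linarith

/-- The dependence between the constraints on four points. -/
theorem sum_stress_mul_slack {n : ℕ} {p : Fin n → Plane} (hp : GeneralPosition p)
    (σ : Fin 4 ↪ Fin n) (f : Params n) (x : Motion n) :
    ∑ i, ∑ j, stressW (p ∘ σ) i j * (edgeForm p x (σ i) (σ j) - f.edge (σ i) (σ j)) +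
        2 * ∑ i, stressα (p ∘ σ) i * (x.2 (σ i) - f.vertex (σ i)) =
      -(2 * ((∑ i : Fin 4, ∑ j ∈ Finset.Ioi i, stressW (p ∘ σ) i j * f.edge (σ i) (σ j)) +
            ∑ j : Fin 4, stressα (p ∘ σ) j * f.vertex (σ j))) := by
  have hq := hp.comp σ
  have h1 := sum_mul_edgeForm (p ∘ σ) (stressW_comm (p ∘ σ)) (x.1 ∘ σ, x.2 ∘ σ)
  simp only [sum_stressW_smul hq, inner_zero_left, ← stressα_eq, zero_sub] at h1
  have h2 : ∑ i, ∑ j, stressW (p ∘ σ) i j * f.edge (σ i) (σ j) =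
      2 * ∑ i : Fin 4, ∑ j ∈ Finset.Ioi i, stressW (p ∘ σ) i j * f.edge (σ i) (σ j) := by
    have e0 : Finset.Ioi (0 : Fin 4) = {1, 2, 3} := by decide
    have e1 : Finset.Ioi (1 : Fin 4) = {2, 3} := by decide
    have e2 : Finset.Ioi (2 : Fin 4) = {3} := by decide
    have e3 : Finset.Ioi (3 : Fin 4) = ∅ := by decide
    rw [Fin.sum_univ_four, Fin.sum_univ_four (fun i => ∑ j ∈ Finset.Ioi i, _), e0, e1, e2, e3]
    simp only [Fin.sum_univ_four, stressW_self]
    rw [stressW_comm _ 1 0, stressW_comm _ 2 0, stressW_comm _ 3 0, stressW_comm _ 2 1,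
      stressW_comm _ 3 1, stressW_comm _ 3 2, f.edge_comm (σ 1) (σ 0), f.edge_comm (σ 2) (σ 0),
      f.edge_comm (σ 3) (σ 0), f.edge_comm (σ 2) (σ 1), f.edge_comm (σ 3) (σ 1),
      f.edge_comm (σ 3) (σ 2)]
    simp
    ring
  have h3 : ∑ i, ∑ j, stressW (p ∘ σ) i j * edgeForm p x (σ i) (σ j) =
      2 * ∑ i, -(stressα (p ∘ σ) i * x.2 (σ i)) := h1
  simp only [mul_sub, Finset.sum_sub_distrib]
  rw [h2, h3, Finset.sum_neg_distrib]
  ring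

/-- Multipliers of the negative part of the stress of four points that are supported on a
non-crossing marked graph are supported on the positive part. -/
theorem MarkedGraph.NonCrossing.of_multipliers {n : ℕ} {p : Fin n → Plane} (hp : GeneralPosition p)
    {T : MarkedGraph n} (hT : T.NonCrossing p) (σ : Fin 4 ↪ Fin n) {y : Fin n → Fin n → ℝ}
    {m : Fin n → ℝ} (hy : ∀ i j, y i j = y j i) (hy0 : ∀ i j, 0 ≤ y i j)
    (hyT : ∀ i j, y i j ≠ 0 → T.graph.Adj i j)
    (hmT : ∀ i, m i ≠ 0 → i ∈ T.marks)
    (h : ∀ x : Motion n, ∑ i, ∑ j, y i j * edgeForm p x i j + ∑ j, m j * x.2 j =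
      ∑ i, ∑ j, max (-stressW (p ∘ σ) i j) 0 * edgeForm p x (σ i) (σ j) +
        2 * ∑ i, max (-stressα (p ∘ σ) i) 0 * x.2 (σ i)) :
    (∀ i j, 0 < stressW (p ∘ σ) i j → T.graph.Adj (σ i) (σ j)) ∧
      ∀ i, 0 < stressα (p ∘ σ) i → σ i ∈ T.marks := by
  classical
  have hq := hp.comp σ
  set W := stressW (p ∘ σ)
  set A := stressα (p ∘ σ)
  have hW : ∀ i j, W i j = W j i := stressW_comm _
  -- The negative parts of the stress and of `α`, extended by zero to all points.
  let c : Fin n → Fin n → ℝ := fun k l =>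
    Function.extend (Prod.map σ σ) (fun e : Fin 4 × Fin 4 => max (-W e.1 e.2) 0) 0 (k, l)
  let d : Fin n → ℝ := Function.extend σ (fun i => max (-A i) 0) 0
  have hσσ : Function.Injective (Prod.map σ σ) := σ.injective.prodMap σ.injective
  have hc : ∀ i j, c (σ i) (σ j) = max (-W i j) 0 := fun i j => hσσ.extend_apply _ _ (i, j)
  have hc1 : ∀ k ∉ Set.range σ, ∀ l, c k l = 0 := fun k hk l =>
    Function.extend_apply' _ _ _ (by
      rintro ⟨⟨i, j⟩, hij⟩
      exact hk ⟨i, congrArg Prod.fst hij⟩)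
  have hc2 : ∀ l ∉ Set.range σ, ∀ k, c k l = 0 := fun l hl k =>
    Function.extend_apply' _ _ _ (by
      rintro ⟨⟨i, j⟩, hij⟩
      exact hl ⟨j, congrArg Prod.snd hij⟩)
  have hd : ∀ i, d (σ i) = max (-A i) 0 := fun i => σ.injective.extend_apply _ _ i
  have hd1 : ∀ k ∉ Set.range σ, d k = 0 := fun k hk => Function.extend_apply' _ _ _ hk
  have hcsymm : ∀ k l, c k l = c l k := by
    intro k l
    by_cases hk : k ∈ Set.range σ
    · by_cases hl : l ∈ Set.range σ
      · obtain ⟨i, rfl⟩ := hk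
        obtain ⟨j, rfl⟩ := hl
        rw [hc, hc, hW]
      · rw [hc2 l hl, hc1 l hl]
    · rw [hc1 k hk, hc2 k hk]
  have heq := equilibrium_of_sum_eq_zero (p := p) (y := fun i j => y i j - c i j)
    (m := fun i => m i - 2 * d i) (fun i j => by rw [hy, hcsymm]) (by
      intro x
      have h1 : ∑ i, ∑ j, max (-W i j) 0 * edgeForm p x (σ i) (σ j) =
          ∑ k, ∑ l, c k l * edgeForm p x k l :=
        Fintype.sum_of_injective σ σ.injective _ _ (fun k hk => by simp [hc1 k hk]) fun i =>
          Fintype.sum_of_injective σ σ.injective _ _ (fun l hl => by simp [hc2 l hl]) fun j => by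
            rw [hc]
      have h2 : ∑ i, max (-A i) 0 * x.2 (σ i) = ∑ k, d k * x.2 k :=
        Fintype.sum_of_injective σ σ.injective _ _ (fun k hk => by simp [hd1 k hk]) fun i => by
          rw [hd]
      have := h x
      rw [h1, h2] at this
      simp only [sub_mul, Finset.sum_sub_distrib, mul_assoc, ← Finset.mul_sum]
      linarith)
  -- Away from the four points the non-negative `y` is itself in equilibrium. A non-zero value at
  -- `k` makes `m k` positive, so `k` is marked and hence pointed, which rules out equilibrium.
  have hout : ∀ k ∉ Set.range σ, ∀ l, y k l = 0 := by
    intro k hk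
    obtain ⟨e1, e2⟩ := heq k
    simp only [hc1 k hk, hd1 k hk, sub_zero, mul_zero] at e1 e2
    by_contra hne
    push Not at hne
    obtain ⟨l, hl⟩ := hne
    have hadj := hyT k l hl
    have hpos : 0 < y k l := (hy0 k l).lt_of_ne' hl
    have hmk : 0 < m k := by
      rw [e2]
      refine mul_pos two_pos (Finset.sum_pos' (fun j _ => mul_nonneg (hy0 k j) (norm_nonneg _))
        ⟨l, Finset.mem_univ l, mul_pos hpos (norm_pos_iff.2 (sub_ne_zero.2 (hp.1.ne hadj.ne)))⟩)
    obtain ⟨u, hu⟩ := hT.2 k (hmT k hmk.ne')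
    have hs := congrArg (fun z => ⟪u, z⟫_ℝ) e1
    simp only [inner_sum, inner_smul_right, inner_zero_right] at hs
    have hneg : ∀ j, T.graph.Adj k j → ⟪u, p k - p j⟫_ℝ < 0 := by
      intro j hj
      have := hu j hj
      rw [← neg_sub, inner_neg_right]
      linarith
    refine absurd hs (Finset.sum_neg' (fun j _ => ?_)
      ⟨l, Finset.mem_univ l, mul_neg_of_pos_of_neg hpos (hneg l hadj)⟩).ne
    rcases eq_or_ne (y k j) 0 with h0 | h0
    · rw [h0, zero_mul]
    · exact mul_nonpos_of_nonneg_of_nonpos (hy0 k j) (hneg j (hyT k j h0)).le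
  have hzero : ∀ k ∉ Set.range σ, ∀ i, y i k - c i k = 0 := fun k hk i => by
    rw [hy, hout k hk, hc2 k hk, sub_zero]
  obtain ⟨s, hs⟩ := exists_eq_mul_stressW hq (μ := fun i j => y (σ i) (σ j) - max (-W i j) 0)
    (fun i j => by rw [hy, hW]) (fun i => by
      rw [← (heq (σ i)).1]
      refine Fintype.sum_of_injective σ σ.injective _ _ (fun k hk => ?_) fun j => ?_
      · rw [hzero k hk, zero_smul]
      · rw [hc]
        rfl)
  have hs' : ∀ i j, y (σ i) (σ j) = max (-W i j) 0 + s * W i j := by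
    intro i j
    rcases eq_or_ne i j with rfl | hij
    · have h0 : W i i = 0 := stressW_self _ _
      rw [h0, neg_zero, max_self, mul_zero, add_zero]
      by_contra h0
      exact (hyT _ _ h0).ne rfl
    · have := hs i j hij
      linarith
  have hms : ∀ i, m (σ i) = 2 * (max (-A i) 0 + s * A i) := by
    intro i
    have h1 := (heq (σ i)).2
    have h2 : s * A i = ∑ k, (y (σ i) k - c (σ i) k) * ‖p (σ i) - p k‖ := by
      simp only [A]
      rw [stressα_eq, Finset.mul_sum]
      refine Fintype.sum_of_injective σ σ.injective _ _ (fun k hk => ?_) fun j => ?_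
      · rw [hzero k hk, zero_mul]
      · rw [hc, hs', ← mul_assoc]
        simp [W]
    rw [← h2, hd] at h1
    linarith
  -- Where the stress is negative, `y` is `1 - s` times its negative part; where it is positive, `y`
  -- is `s` times the stress. The same holds for `m` and `α`, up to a factor 2.
  rcases lt_or_ge s 1 with hs1 | hs1
  · refine absurd hT (MarkedGraph.not_nonCrossing hp σ (fun i j hij => hyT _ _ ?_)
      fun i hi => hmT _ ?_)
    · have hij' : W i j < 0 := hij
      rw [hs', max_eq_left (by linarith)]
      nlinarith
    · have hi' : A i < 0 := hi
      rw [hms, max_eq_left (by linarith)]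
      nlinarith
  · refine ⟨fun i j hij => hyT _ _ ?_, fun i hi => hmT _ ?_⟩
    · rw [hs', max_eq_right (by linarith)]
      nlinarith
    · rw [hms, max_eq_right (by linarith)]
      nlinarith

/-! ### Validity -/

theorem isValid_of_forall_pos {n : ℕ} {p : Fin n → Plane} (hp : GeneralPosition p) {a b : Fin n}
    {f : Params n}
    (h : ∀ σ : Fin 4 ↪ Fin n,
      0 < (∑ i : Fin 4, ∑ j ∈ Finset.Ioi i, stressW (p ∘ σ) i j * f.edge (σ i) (σ j)) +
        ∑ j : Fin 4, stressα (p ∘ σ) j * f.vertex (σ j)) :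
    IsValid p a b f := by
  intro F hF _ x hx
  obtain ⟨-, hxE, hxM⟩ := hF.subset (intrinsicInterior_subset hx)
  by_contra hnc
  obtain ⟨σ, hE, hM⟩ := MarkedGraph.exists_stress_of_not_nonCrossing hp hnc
  have hid := sum_stress_mul_slack hp σ f x
  have h1 : 0 ≤ ∑ i, ∑ j, stressW (p ∘ σ) i j *
      (edgeForm p x (σ i) (σ j) - f.edge (σ i) (σ j)) := by
    refine Finset.sum_nonneg fun i _ => Finset.sum_nonneg fun j _ => ?_
    rcases lt_or_ge (stressW (p ∘ σ) i j) 0 with hw | hw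
    · rw [(hE i j hw).2, sub_self, mul_zero]
    · rcases eq_or_ne i j with rfl | hij
      · rw [stressW_self, zero_mul]
      · exact mul_nonneg hw (sub_nonneg.2 (hxE _ _ (σ.injective.ne hij)))
  have h2 : 0 ≤ ∑ i, stressα (p ∘ σ) i * (x.2 (σ i) - f.vertex (σ i)) := by
    refine Finset.sum_nonneg fun i _ => ?_
    rcases lt_or_ge (stressα (p ∘ σ) i) 0 with hα | hα
    · rw [show x.2 (σ i) = f.vertex (σ i) from hM i hα, sub_self, mul_zero]
    · exact mul_nonneg hα (sub_nonneg.2 (hxM _))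
  linarith [h σ]

/-- The negative part of the stress of four points, as a linear form. -/
noncomputable def negStressForm {n : ℕ} (p : Fin n → Plane) (σ : Fin 4 ↪ Fin n) :
    Motion n →ₗ[ℝ] ℝ :=
  ∑ i, ∑ j, max (-stressW (p ∘ σ) i j) 0 • edgeFormL p (σ i) (σ j) +
    (2 : ℝ) • ∑ i, max (-stressα (p ∘ σ) i) 0 • markFormL (σ i)

theorem negStressForm_apply {n : ℕ} (p : Fin n → Plane) (σ : Fin 4 ↪ Fin n) (x : Motion n) :
    negStressForm p σ x =
      ∑ i, ∑ j, max (-stressW (p ∘ σ) i j) 0 * edgeForm p x (σ i) (σ j) +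
        2 * ∑ i, max (-stressα (p ∘ σ) i) 0 * x.2 (σ i) := by
  simp only [negStressForm, LinearMap.add_apply, LinearMap.smul_apply, LinearMap.sum_apply,
    smul_eq_mul]
  rfl

/-- A non-negative combination of the constraints; it bounds the objective below, so that a minimum
exists. -/
theorem le_negStressForm {n : ℕ} {p : Fin n → Plane} (σ : Fin 4 ↪ Fin n) {f : Params n}
    {x : Motion n} (hE : ∀ i j : Fin n, i ≠ j → f.edge i j ≤ edgeForm p x i j)
    (hM : ∀ j, f.vertex j ≤ x.2 j) :
    ∑ i, ∑ j, max (-stressW (p ∘ σ) i j) 0 * f.edge (σ i) (σ j) +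
        2 * ∑ i, max (-stressα (p ∘ σ) i) 0 * f.vertex (σ i) ≤ negStressForm p σ x := by
  rw [negStressForm_apply]
  refine add_le_add (Finset.sum_le_sum fun i _ => Finset.sum_le_sum fun j _ => ?_)
    (mul_le_mul_of_nonneg_left (Finset.sum_le_sum fun i _ =>
      mul_le_mul_of_nonneg_left (hM _) (le_max_right _ _)) two_pos.le)
  rcases eq_or_ne i j with rfl | hij
  · simp [stressW_self]
  · exact mul_le_mul_of_nonneg_left (hE _ _ (σ.injective.ne hij)) (le_max_right _ _)

/-- If `f` is valid, then some point of the polyhedron has a non-crossing tight graph and minimizes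
the negative part of the stress of four given points, also among all motions that satisfy the
constraints without being normalized. -/
theorem IsValid.exists_minimizer {n : ℕ} {p : Fin n → Plane} (hp : GeneralPosition p)
    {a b : Fin n} (hab : p a 1 ≠ p b 1) {f : Params n} (hf : IsValid p a b f)
    (σ : Fin 4 ↪ Fin n) :
    ∃ x, (∀ e, constraintBound f e ≤ constraintForm p e x) ∧ (tightGraph p f x).NonCrossing p ∧
      ∀ z, (∀ e, constraintBound f e ≤ constraintForm p e z) →
        negStressForm p σ x ≤ negStressForm p σ z := by
  obtain ⟨x₀, hx₀⟩ := exists_constraints hp f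
  -- The minimum is taken over all motions, not just normalized ones, so that the multiplier
  -- identity later holds on the whole space and yields equilibrium at every point.
  obtain ⟨x₁, hx₁, hmin₁⟩ := exists_forall_le_of_polyhedron (constraintForm p) (constraintBound f)
    (negStressForm p σ) x₀ ((constraints_iff p f x₀).2 hx₀) _ fun x hx =>
      le_negStressForm σ ((constraints_iff p f x).1 hx).1 ((constraints_iff p f x).1 hx).2
  have normalize : ∀ z, (∀ e, constraintBound f e ≤ constraintForm p e z) →
      ∃ z' ∈ polyhedron p a b f, negStressForm p σ z' = negStressForm p σ z := by
    intro z hz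
    obtain ⟨z', hz', hzE, hzM⟩ := exists_normalized hab z
    rw [constraints_iff] at hz
    refine ⟨z', ⟨hz', fun i j hij => ?_, fun j => ?_⟩, ?_⟩
    · rw [hzE]
      exact hz.1 i j hij
    · rw [hzM]
      exact hz.2 j
    · simp only [negStressForm_apply, hzE, hzM]
  obtain ⟨x₂, hx₂, hx₂₁⟩ := normalize x₁ hx₁
  let l : StrongDual ℝ (Motion n) := LinearMap.toContinuousLinearMap (-negStressForm p σ)
  have hl : ∀ z, l z = -negStressForm p σ z := fun z => rfl
  set F := {x ∈ polyhedron p a b f | ∀ y ∈ polyhedron p a b f, l y ≤ l x} with hFdef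
  have hF : IsExposed ℝ (polyhedron p a b f) F := fun _ => ⟨l, rfl⟩
  have hFne : F.Nonempty := by
    refine ⟨x₂, hx₂, fun z hz => ?_⟩
    rw [hl, hl, hx₂₁]
    exact neg_le_neg (hmin₁ z ((constraints_iff p f z).2 hz.2))
  obtain ⟨x, hx⟩ := hFne.intrinsicInterior (hF.convex (convex_polyhedron p a b f))
  obtain ⟨hxP, hxmin⟩ := intrinsicInterior_subset hx
  refine ⟨x, (constraints_iff p f x).2 hxP.2, hf F hF hFne x hx, fun z hz => ?_⟩
  obtain ⟨z', hz', hzz'⟩ := normalize z hz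
  have := hxmin z' hz'
  rw [hl, hl] at this
  linarith

theorem IsValid.pos {n : ℕ} {p : Fin n → Plane} (hp : GeneralPosition p) {a b : Fin n}
    (hab : p a 1 ≠ p b 1) {f : Params n} (hf : IsValid p a b f) (σ : Fin 4 ↪ Fin n) :
    0 < (∑ i : Fin 4, ∑ j ∈ Finset.Ioi i, stressW (p ∘ σ) i j * f.edge (σ i) (σ j)) +
      ∑ j : Fin 4, stressα (p ∘ σ) j * f.vertex (σ j) := by
  obtain ⟨x, hx, hT, hmin⟩ := hf.exists_minimizer hp hab σ
  obtain ⟨y, hy0, hytight, hy⟩ := exists_multipliers_of_minimizer _ _ _ x hx hmin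
  obtain ⟨hxE, hxM⟩ := (constraints_iff p f x).1 hx
  have htight : ∀ i j, y (Sum.inl (i, j)) ≠ 0 → (tightGraph p f x).graph.Adj i j := by
    intro i j hij
    have h1 := hytight _ hij
    simp only [constraintForm, constraintBound, Sum.elim_inl] at h1
    change edgeForm p x i j = _ at h1
    split_ifs at h1 with h2
    · subst h2
      rw [edgeForm_self] at h1
      norm_num at h1
    · exact ⟨h2, h1⟩
  obtain ⟨hE, hM⟩ := hT.of_multipliers hp σ
    -- Constraints are indexed by ordered pairs, so the multipliers are symmetrized.
    (y := fun i j => (y (Sum.inl (i, j)) + y (Sum.inl (j, i))) / 2) (m := fun j => y (Sum.inr j))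
    (fun i j => by rw [add_comm])
    (fun i j => div_nonneg (add_nonneg (hy0 _) (hy0 _)) two_pos.le)
    (fun i j hij => by
      by_cases h1 : y (Sum.inl (i, j)) = 0
      · refine (htight j i fun h2 => hij ?_).symm
        simp [h1, h2]
      · exact htight i j h1)
    (fun j hj => hytight _ hj)
    (fun z => by
      have hz := hy z
      rw [negStressForm_apply, Fintype.sum_sum_type, Fintype.sum_prod_type] at hz
      rw [hz]
      have h1 : ∑ i, ∑ j, y (Sum.inl (j, i)) * edgeForm p z i j =
          ∑ i, ∑ j, y (Sum.inl (i, j)) * edgeForm p z i j := by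
        rw [Finset.sum_comm]
        simp only [fun i j => edgeForm_comm p z j i]
      have h2 : ∑ i, ∑ j, (y (Sum.inl (i, j)) + y (Sum.inl (j, i))) / 2 * edgeForm p z i j =
          ∑ i, ∑ j, y (Sum.inl (i, j)) * edgeForm p z i j := by
        have h3 : ∀ i j, (y (Sum.inl (i, j)) + y (Sum.inl (j, i))) / 2 * edgeForm p z i j =
            (y (Sum.inl (i, j)) * edgeForm p z i j + y (Sum.inl (j, i)) * edgeForm p z i j) / 2 :=
          fun i j => by ring
        simp only [h3, ← Finset.sum_div, Finset.sum_add_distrib]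
        rw [h1]
        ring
      rw [h2]
      rfl)
  have hid := sum_stress_mul_slack hp σ f x
  have t1 : ∀ i j, stressW (p ∘ σ) i j * (edgeForm p x (σ i) (σ j) - f.edge (σ i) (σ j)) ≤ 0 := by
    intro i j
    rcases lt_or_ge 0 (stressW (p ∘ σ) i j) with hw | hw
    · rw [(hE i j hw).2, sub_self, mul_zero]
    · rcases eq_or_ne i j with rfl | hij
      · rw [stressW_self, zero_mul]
      · exact mul_nonpos_of_nonpos_of_nonneg hw (sub_nonneg.2 (hxE _ _ (σ.injective.ne hij)))
  have t2 : ∀ i, stressα (p ∘ σ) i * (x.2 (σ i) - f.vertex (σ i)) ≤ 0 := by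
    intro i
    rcases lt_or_ge 0 (stressα (p ∘ σ) i) with hα | hα
    · rw [show x.2 (σ i) = f.vertex (σ i) from hM i hα, sub_self, mul_zero]
    · exact mul_nonpos_of_nonpos_of_nonneg hα (sub_nonneg.2 (hxM _))
  have s1 := fun i => Finset.sum_nonpos fun j (_ : j ∈ Finset.univ) => t1 i j
  have s2 := Finset.sum_nonpos fun i (_ : i ∈ Finset.univ) => s1 i
  have s3 := Finset.sum_nonpos fun i (_ : i ∈ Finset.univ) => t2 i
  -- Every term of the slack identity is now non-positive. If the claim fails, the total is also
  -- non-negative, so all terms vanish and the negative-stress constraints are tight too.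
  by_contra hneg
  push Not at hneg
  have z2 := le_antisymm s2 (by linarith)
  have z3 := le_antisymm s3 (by linarith)
  rw [Finset.sum_eq_zero_iff_of_nonpos fun i _ => s1 i] at z2
  rw [Finset.sum_eq_zero_iff_of_nonpos fun i _ => t2 i] at z3
  refine MarkedGraph.not_nonCrossing hp σ (fun i j hij => ?_) (fun i hi => ?_) hT
  · have z := z2 i (Finset.mem_univ i)
    rw [Finset.sum_eq_zero_iff_of_nonpos fun j _ => t1 i j] at z
    refine ⟨σ.injective.ne ?_, ?_⟩
    · rintro rfl
      rw [stressW_self] at hij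
      exact lt_irrefl _ hij
    · exact sub_eq_zero.1 ((mul_eq_zero.1 (z j (Finset.mem_univ j))).resolve_left hij.ne)
  · exact sub_eq_zero.1 ((mul_eq_zero.1 (z3 i (Finset.mem_univ i))).resolve_left hi.ne)

end ExpansionPolyhedron

theorem mainTheorem5 {n : ℕ} (p : Fin n → ExpansionPolyhedron.Plane)
    (hp : ExpansionPolyhedron.GeneralPosition p)
    (a b : Fin n) (hab : p a 1 ≠ p b 1) (f : ExpansionPolyhedron.Params n) :
    ExpansionPolyhedron.IsValid p a b f ↔
      ∀ σ : Fin 4 ↪ Fin n,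
        0 < (∑ i : Fin 4, ∑ j ∈ Finset.Ioi i,
              ExpansionPolyhedron.stressW (p ∘ σ) i j * f.edge (σ i) (σ j)) +
            ∑ j : Fin 4, ExpansionPolyhedron.stressα (p ∘ σ) j * f.vertex (σ j) :=
  ⟨fun hf σ => hf.pos hp hab σ, ExpansionPolyhedron.isValid_of_forall_pos hp⟩
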